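/- Let $q$ be a prime power, let $n\ge 2$ and $r$ be integers with $n/2\le r\le n-1$ and $\gcd(n,r)=1$, and assume that $q$ is odd if $n=2$. Put $T_n(z)=z+z^q+\cdots+z^{q^{n-1}}$, let $f_r(x)$ be the remainder of $T_n(x^{1+q^r})$ modulo $x^{q^n}-x$, and let $\mathcal X_{n,r}$ be the nonsingular projective model of the plane curve $T_n(y)=f_r(x)$ over $\mathbb F_{q^n}$. For a rational point $P$ of a curve, let $H(P)$ be the set of all $m\in\mathbb N_0$ such that some nonzero rational function has pole divisor $mP$; $H(P)$ is called symmetric if its largest gap (element of $\mathbb N_0\setminus H(P)$) equals $2g-1$, where $g$ is the number of its gaps. The plane curve $T_n(y)=f_r(x)$ is geometrically irreducible, exactly one point $P_\infty$ of $\mathcal X_{n,r}$ lies over the point $(0:1:0)$ of its projective closure, and $P_\infty$ is $\mathbb F_{q^n}$-rational. Moreover, $\mathcal X_{n,r}$ is a Castle curve (with respect to $P_\infty$): the Weierstrass semigroup $H(P_\infty)=\{0=m_1<m_2<\cdots\}$ is symmetric, and $$\#\mathcal X_{n,r}(\mathbb F_{q^n})=m_2\,q^n+1 .$$ Here $m_2=q^{n-1}$,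 so that $\#\mathcal X_{n,r}(\mathbb F_{q^n})=q^{2n-1}+1$. -/

import Mathlib

open Polynomial

noncomputable section

namespace CastleCurve

/-! ### Points of the nonsingular projective model of a function field -/

/-- A place of a function field `F` over `K`: a discrete valuation ring of `F` that contains `K`
and has fraction field `F`. The places are the closed points of the nonsingular projective curve
over `K` with function field `F`. -/
structure Place (K F : Type*) [Field K] [Field F] [Algebra K F] where
  /-- the local ring at the point -/
  ring : ValuationSubring F
  isDVR : IsDiscreteValuationRing ring
  algebraMap_mem : ∀ c : K, algebraMap K F c ∈ ring

namespace Place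

variable {K F : Type*} [Field K] [Field F] [Algebra K F]

/-- The normalized discrete valuation at `P`, written multiplicatively: its value at `f ≠ 0` is
`exp (-v_P(f))`. -/
def valuation (P : Place K F) : Valuation F (WithZero (Multiplicative ℤ)) :=
  haveI := P.isDVR
  (IsDiscreteValuationRing.maximalIdeal P.ring).valuation F

/-- The integer `v_P(f)` (with the junk value `0` at `f = 0`). -/
def ord (P : Place K F) (f : F) : ℤ := -WithZero.log (P.valuation f)

/-- The coefficient of `P` in the pole divisor of `f`, that is `max (-v_P(f)) 0`. -/
def poleOrder (P : Place K F) (f : F) : ℕ := (-P.ord f).toNat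

/-- The inclusion of the constants into the local ring at `P`. -/
def constants (P : Place K F) : K →+* P.ring :=
  (algebraMap K F).codRestrict P.ring.toSubring P.algebraMap_mem

/-- `P` is a `K`-rational point: its residue field is `K`. -/
def IsRational (P : Place K F) : Prop :=
  Function.Surjective ((IsLocalRing.residue P.ring).comp P.constants)

/-- The Weierstrass semigroup `H(P)`: the `m` for which some `f ≠ 0` has pole divisor `m P`. -/
def weierstrassSemigroup (P : Place K F) : Set ℕ :=
  {m | ∃ f : F, f ≠ 0 ∧ P.poleOrder f = m ∧ ∀ Q : Place K F, Q ≠ P → Q.poleOrder f = 0}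

end Place

/-- A semigroup `S ⊆ ℕ` is symmetric if its largest gap is `2 g - 1`, where `g` is the number of
its gaps. -/
def IsSymmetric (S : Set ℕ) : Prop :=
  ∃ l : ℕ, IsGreatest Sᶜ l ∧ l + 1 = 2 * Sᶜ.ncard

/-- The curve with function field `F` over `K` is a Castle curve with respect to the rational point
`P`: the semigroup `H(P) = {0 = m₁ < m₂ < ⋯}` is symmetric and the curve has exactly
`m₂ * #K + 1` rational points. -/
def IsCastle {K F : Type*} [Field K] [Field F] [Algebra K F] (P : Place K F) : Prop :=
  P.IsRational ∧ IsSymmetric P.weierstrassSemigroup ∧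
    ∃ m₂ : ℕ, IsLeast {m | m ∈ P.weierstrassSemigroup ∧ m ≠ 0} m₂ ∧
      Nat.card {Q : Place K F // Q.IsRational} = m₂ * Nat.card K + 1

/-! ### The curves `T_n(y) = f_r(x)` -/

section Curve

variable (K : Type*) [Field K] (q n r : ℕ)

/-- `T_n(z) = z + z ^ q + ⋯ + z ^ (q ^ (n - 1))`. -/
def T {A : Type*} [Semiring A] (z : A) : A := ∑ i ∈ Finset.range n, z ^ q ^ i

/-- `f_r(x)`, the remainder of `T_n(x ^ (1 + q ^ r))` modulo `x ^ (q ^ n) - x`. -/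
def fPoly : K[X] := T q n ((X : K[X]) ^ (1 + q ^ r)) %ₘ (X ^ q ^ n - X)

/-- The polynomial `T_n(Y) - f_r(X)`, as an element of `K[X][Y]`. -/
def curvePoly : K[X][X] := T q n (X : K[X][X]) - C (fPoly K q n r)

/-- The coordinate ring `K[X, Y] / (T_n(Y) - f_r(X))` of the affine curve. -/
abbrev CoordinateRing : Type _ := AdjoinRoot (curvePoly K q n r)

/-- The fraction field `K(x, y)` of the coordinate ring. -/
abbrev FunctionField : Type _ := FractionRing (CoordinateRing K q n r)

/-- The coordinate function `x`. -/
def xFun : FunctionField K q n r :=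
  algebraMap (CoordinateRing K q n r) _ (AdjoinRoot.of _ X)

/-- The coordinate function `y`. -/
def yFun : FunctionField K q n r :=
  algebraMap (CoordinateRing K q n r) _ (AdjoinRoot.root _)

/-- The affine curve is geometrically irreducible. -/
def IsGeometricallyIrreducible : Prop :=
  Irreducible ((curvePoly K q n r).map (mapRingHom (algebraMap K (AlgebraicClosure K))))

/-- The place `P` lies over the point `(0 : 1 : 0)` of the projective closure of the plane curve:
the affine coordinates `x / y` and `1 / y` around that point vanish at `P`. -/
def LiesOverInfinity [IsDomain (CoordinateRing K q n r)]
    (P : Place K (FunctionField K q n r)) : Prop :=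
  P.valuation (xFun K q n r / yFun K q n r) < 1 ∧ P.valuation (1 / yFun K q n r) < 1

end Curve

end CastleCurve

end

/-!
Reduction modulo `x ^ (q ^ n) - x` makes the curve depend only on `r` modulo `n`. For `n = s + r` it
turns the equation into `T_n(y) = T_s(x ^ (1 + q ^ r)) + T_r(x ^ (1 + q ^ s))`, which is symmetric
in `s` and `r`, so let `s ≤ r`. If `s = r = 1`, this is `y ^ q + y = 2 x ^ (q + 1)`, a Hermitian
curve. If `s < r`, the equation says that
`T_s(x ^ (1 + q ^ r) - y) = T_r(y ^ (q ^ s) - x ^ (1 + q ^ s))`, and since `s` and `r` are coprime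
there is a function `t` with `T_r(t) = x ^ (1 + q ^ r) - y` and
`T_s(t) = y ^ (q ^ s) - x ^ (1 + q ^ s)`. From `t` one obtains two more functions `u` and `w` such
that each of `y, t, u, w` has a power equal to a constant times a monomial plus terms with a
smaller pole at infinity.

These relations form a rewriting system. It reduces every function to a combination of
`q ^ (n - 1)` monomials over `K[x]`, and since this is the rank of the coordinate ring, the reduced
monomials are linearly independent. Hence the weight of the leading monomial is a valuation: the
coordinate ring is a domain, there is a single place at infinity, and its pole numbers are the
weights of the monomials. The weights of the reduced monomials without `x` form a box of
representatives of the residues modulo `q ^ (n - 1)`, and complementing the exponents in this box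
makes the semigroup symmetric. The rational points outside infinity are the solutions of
`T_n(y - x ^ (1 + q ^ r)) = 0` in `K`, where `T_n` is the trace to the field with `q` elements.
-/

open WithZero

namespace CastleCurve

section Additive

variable {A : Type*} [CommRing A] {q : ℕ}

/-- Raising to the power `q` is additive on `A`, as in characteristic `p` for `q` a power of `p`.
It is the only trace of the characteristic that the identities between powers and `T_n` need. -/
def PowAdditive (A : Type*) [CommRing A] (q : ℕ) : Prop := ∀ a b : A, (a + b) ^ q = a ^ q + b ^ q

namespace PowAdditive

lemma of_charP (p m : ℕ) [Fact p.Prime] [CharP A p] : PowAdditive A (p ^ m) :=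
  fun a b => add_pow_char_pow a b p m

lemma add_pow (h : PowAdditive A q) (i : ℕ) (a b : A) :
    (a + b) ^ q ^ i = a ^ q ^ i + b ^ q ^ i := by
  induction i with
  | zero => simp
  | succ i ih => rw [pow_succ, pow_mul, pow_mul, pow_mul, ih, h]

/-- The additive map `a ↦ a ^ (q ^ i)`. -/
def powHom (h : PowAdditive A q) (i : ℕ) : A →+ A := AddMonoidHom.mk' (· ^ q ^ i) (h.add_pow i)

lemma sub_pow (h : PowAdditive A q) (i : ℕ) (a b : A) :
    (a - b) ^ q ^ i = a ^ q ^ i - b ^ q ^ i :=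
  map_sub (h.powHom i) a b

lemma sum_pow (h : PowAdditive A q) (i : ℕ) {ι : Type*} (s : Finset ι) (f : ι → A) :
    (∑ j ∈ s, f j) ^ q ^ i = ∑ j ∈ s, f j ^ q ^ i :=
  map_sum (h.powHom i) f s

end PowAdditive

lemma T_zero (z : A) : T q 0 z = 0 := by simp [T]

lemma T_one (z : A) : T q 1 z = z := by simp [T]

lemma T_succ (n : ℕ) (z : A) : T q (n + 1) z = T q n z + z ^ q ^ n :=
  Finset.sum_range_succ _ _

lemma map_T {R S : Type*} [Semiring R] [Semiring S] (φ : R →+* S) (q n : ℕ) (z : R) :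
    φ (T q n z) = T q n (φ z) := by
  simp [T]

lemma T_sub (h : PowAdditive A q) (n : ℕ) (a b : A) : T q n (a - b) = T q n a - T q n b := by
  simp [T, h.sub_pow]

lemma T_pow (h : PowAdditive A q) (n i : ℕ) (z : A) : T q n (z ^ q ^ i) = T q n z ^ q ^ i := by
  simp only [T, h.sum_pow, pow_right_comm z]

lemma T_add_index (h : PowAdditive A q) (a b : ℕ) (z : A) :
    T q (a + b) z = T q a z + T q b z ^ q ^ a := by
  rw [← T_pow h]
  simp only [T, Finset.sum_range_add, ← pow_mul, ← pow_add]

/-- For coprime `a` and `b` the Euclidean algorithm shows that `T_a` and `T_b` generate the unit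
ideal of the ring of additive polynomials. -/
lemma exists_T_eq_and_T_eq (h : PowAdditive A q) {a b : ℕ} (hab : Nat.Coprime a b) {z w : A}
    (hzw : T q a z = T q b w) : ∃ t, T q b t = z ∧ T q a t = w := by
  induction hN : a + b using Nat.strong_induction_on generalizing a b z w with
  | _ N ih =>
    wlog hle : a ≤ b generalizing a b z w
    · obtain ⟨t, hw, hz⟩ := this hab.symm hzw.symm (by rw [← hN, add_comm]) (by omega)
      exact ⟨t, hz, hw⟩
    obtain rfl | ha := Nat.eq_zero_or_pos a
    · obtain rfl : b = 1 := by simpa using hab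
      rw [T_zero, T_one] at hzw
      exact ⟨z, T_one z, by rw [T_zero, hzw]⟩
    obtain ⟨c, rfl⟩ := Nat.exists_eq_add_of_le' hle
    have hc : T q a (z - w ^ q ^ c) = T q c w := by
      rw [T_sub h, hzw, T_add_index h, T_pow h, add_sub_cancel_right]
    obtain ⟨t, hz, hw⟩ := ih (a + c) (by omega) (by simpa using hab) hc rfl
    exact ⟨t, by rw [T_add_index h, hz, hw, sub_add_cancel], hw⟩

end Additive

section Relations

variable {A : Type*} [CommRing A] {q : ℕ}

lemma exists_parameter (h : PowAdditive A q) {s r : ℕ} (hcop : Nat.Coprime r s) {x y : A}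
    (hxy : T q (s + r) y = T q s (x ^ (1 + q ^ r)) + T q r (x ^ (1 + q ^ s))) :
    ∃ t, T q s t = y ^ q ^ s - x ^ (1 + q ^ s) ∧ T q r t = x ^ (1 + q ^ r) - y := by
  refine exists_T_eq_and_T_eq h hcop ?_
  rw [T_sub h, T_sub h, T_pow h]
  rw [T_add_index h] at hxy
  linear_combination hxy

lemma sub_T_pow (h : PowAdditive A q) {s k E : ℕ} {x y t : A} (hE : E + 1 = q ^ k)
    (hs : T q s t = y ^ q ^ s - x ^ (1 + q ^ s))
    (hr : T q (s + k) t = x ^ (1 + q ^ (s + k)) - y) :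
    (y * x ^ E - T q k t) ^ q ^ s = y + (1 + x ^ (q ^ s * E)) * T q s t := by
  have hx : x ^ (1 + q ^ (s + k)) = x ^ (q ^ s * E) * x ^ (1 + q ^ s) := by
    rw [pow_add q, ← hE]
    ring
  rw [hx] at hr
  rw [h.sub_pow, mul_pow, ← pow_mul x, mul_comm E]
  linear_combination T_add_index h s k t - hr - x ^ (q ^ s * E) * hs

/-- Raise `hw` to the powers `1, q, …, q ^ (i - 1)` and eliminate the powers of `u` in between. -/
lemma iterate_pow_relation (h : PowAdditive A q) {E s : ℕ} {x t u w : A} (hq : 1 ≤ q)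
    (hw : u ^ q = t * x ^ (q * E) + u * x ^ ((q - 1) * E) + w) {i : ℕ} (hi : i ≤ s) :
    u ^ q ^ i * x ^ ((q ^ s - q ^ i) * E) = u * x ^ ((q ^ s - 1) * E) + x ^ (q ^ s * E) * T q i t
      + ∑ j ∈ Finset.range i, x ^ ((q ^ s - q ^ (j + 1)) * E) * w ^ q ^ j := by
  induction i with
  | zero => simp [T_zero]
  | succ i ih =>
    have hle : q ^ (i + 1) ≤ q ^ s := Nat.pow_le_pow_right hq hi
    have hle' : q ^ i ≤ q ^ (i + 1) := Nat.pow_le_pow_right hq i.le_succ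
    have hu : u ^ q ^ (i + 1) = t ^ q ^ i * x ^ (q ^ (i + 1) * E)
        + u ^ q ^ i * x ^ ((q ^ (i + 1) - q ^ i) * E) + w ^ q ^ i := by
      have hexp : q ^ (i + 1) - q ^ i = (q - 1) * q ^ i := by rw [Nat.sub_mul, one_mul, pow_succ']
      rw [hexp, pow_succ' q i, pow_mul, hw, h.add_pow, h.add_pow, mul_pow, mul_pow, ← pow_mul,
        ← pow_mul]
      ring_nf
    have ht : x ^ (q ^ (i + 1) * E) * x ^ ((q ^ s - q ^ (i + 1)) * E) = x ^ (q ^ s * E) := by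
      rw [← pow_add, ← add_mul, Nat.add_sub_cancel' hle]
    have hxu : x ^ ((q ^ (i + 1) - q ^ i) * E) * x ^ ((q ^ s - q ^ (i + 1)) * E)
        = x ^ ((q ^ s - q ^ i) * E) := by
      rw [← pow_add, ← add_mul, add_comm, Nat.sub_add_sub_cancel hle hle']
    rw [Finset.sum_range_succ, T_succ, hu]
    linear_combination ih (by omega) + t ^ q ^ i * ht + u ^ q ^ i * hxu

/-- The relations between the coordinates `x, y` of the curve
`T_{s+r}(y) = T_s(x ^ (1 + q ^ r)) + T_r(x ^ (1 + q ^ s))`, where `s = σ + 1` and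
`r = s + (d + 1)`, and three further functions `t, u, w` without poles outside infinity. Each
relation expresses a power of a generator by a leading term and terms with a smaller pole at
infinity, so that together they determine all pole orders at infinity. -/
structure IsGeneratorSystem (q σ d : ℕ) (x y t u w : A) : Prop where
  y_pow : y ^ q ^ (σ + 1) = x ^ (1 + q ^ (σ + 1)) + T q (σ + 1) t
  t_pow : t ^ q ^ d = x ^ (q ^ (d + 1) - 1) * y - (T q d t + u)
  u_pow : u ^ q = x ^ (q * (q ^ (d + 1) - 1)) * t + (x ^ ((q - 1) * (q ^ (d + 1) - 1)) * u + w)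
  w_pow : w ^ q ^ σ = -(x ^ ((q ^ (σ + 1) - 1) * (q ^ (d + 1) - 1)) * u) + (y + T q (σ + 1) t
    - ∑ j ∈ Finset.range σ, x ^ ((q ^ (σ + 1) - q ^ (j + 1)) * (q ^ (d + 1) - 1)) * w ^ q ^ j)

lemma exists_isGeneratorSystem (h : PowAdditive A q) (hq : 1 ≤ q) {σ d : ℕ}
    (hcop : Nat.Coprime (σ + 1 + (d + 1)) (σ + 1)) {x y : A}
    (hxy : T q (σ + 1 + (σ + 1 + (d + 1))) y = T q (σ + 1) (x ^ (1 + q ^ (σ + 1 + (d + 1))))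
      + T q (σ + 1 + (d + 1)) (x ^ (1 + q ^ (σ + 1)))) :
    ∃ t u w : A, IsGeneratorSystem q σ d x y t u w := by
  obtain ⟨t, hs, hr⟩ := exists_parameter h hcop hxy
  have hE : q ^ (d + 1) - 1 + 1 = q ^ (d + 1) := Nat.sub_add_cancel (Nat.one_le_pow _ _ hq)
  have hu := sub_T_pow h hE hs hr
  generalize hu_def : y * x ^ (q ^ (d + 1) - 1) - T q (d + 1) t = u at hu
  have hw := iterate_pow_relation (E := q ^ (d + 1) - 1) (x := x) (t := t) (u := u)
    (w := u ^ q - t * x ^ (q * (q ^ (d + 1) - 1)) - u * x ^ ((q - 1) * (q ^ (d + 1) - 1)))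
    h hq (by ring) (le_refl (σ + 1))
  generalize hw_def : u ^ q - t * x ^ (q * (q ^ (d + 1) - 1))
    - u * x ^ ((q - 1) * (q ^ (d + 1) - 1)) = w at hw
  refine ⟨t, u, w, by linear_combination -hs, ?_, by linear_combination hw_def, ?_⟩
  · rw [T_succ] at hu_def
    linear_combination -hu_def
  · rw [Finset.sum_range_succ] at hw
    simp only [Nat.sub_self, zero_mul, pow_zero, one_mul, mul_one] at hw
    linear_combination hu - hw

end Relations

section Filtration

variable {A : Type*} [CommRing A]

/-- The index at which `f` enters the filtration behaves like a degree increased by one. -/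
lemma exists_valuation_of_filtration [Nontrivial A] (G : ℕ → AddSubgroup A) (hmono : Monotone G)
    (hzero : G 0 = ⊥) (hone : 1 ∈ G 1) (hex : ∀ f, ∃ N, f ∈ G N)
    (hmul : ∀ N M f g, f ∈ G (N + 1) → f ∉ G N → g ∈ G (M + 1) → g ∉ G M →
      f * g ∈ G (N + M + 1) ∧ f * g ∉ G (N + M)) :
    ∃ v : Valuation A ℤᵐ⁰, ∀ f (N : ℕ), v f < exp (N : ℤ) ↔ f ∈ G N := by
  classical
  let index (f : A) : ℕ := Nat.find (hex f)
  have index_le {f N} : index f ≤ N ↔ f ∈ G N :=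
    ⟨fun h => hmono h (Nat.find_spec (hex f)), Nat.find_min' (hex f)⟩
  have index_eq_succ {f N} : index f = N + 1 ↔ f ∈ G (N + 1) ∧ f ∉ G N := by
    rw [← index_le, ← index_le]
    omega
  have index_zero : index 0 = 0 := Nat.le_zero.mp (index_le.mpr (zero_mem _))
  have index_ne_zero {f} (hf : f ≠ 0) : ∃ N, index f = N + 1 := by
    refine Nat.exists_eq_succ_of_ne_zero fun h => hf ?_
    simpa [hzero] using index_le.mp h.le
  let ψ : ℕ → ℤᵐ⁰ := fun N => N.casesOn 0 fun N => exp (N : ℤ)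
  have hψ : StrictMono ψ := strictMono_nat_of_lt_succ fun N => by
    cases N <;> simp [ψ, ← exp_zero]
  refine ⟨{ toFun f := ψ (index f)
            map_zero' := by rw [index_zero]; rfl
            map_one' := by rw [index_eq_succ.mpr ⟨hone, by simp [hzero]⟩]; rfl
            map_mul' f g := ?_
            map_add_le_max' f g := ?_ }, fun f N => ?_⟩
  · obtain rfl | hf := eq_or_ne f 0
    · simp [index_zero, ψ]
    obtain rfl | hg := eq_or_ne g 0
    · simp [index_zero, ψ]
    obtain ⟨N, hN⟩ := index_ne_zero hf
    obtain ⟨M, hM⟩ := index_ne_zero hg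
    obtain ⟨hf₁, hf₂⟩ := index_eq_succ.mp hN
    obtain ⟨hg₁, hg₂⟩ := index_eq_succ.mp hM
    rw [index_eq_succ.mpr (hmul N M f g hf₁ hf₂ hg₁ hg₂), hN, hM]
    simp [ψ, exp_add]
  · rw [← hψ.monotone.map_max]
    exact hψ.monotone (index_le.mpr (add_mem (index_le.mp (le_max_left _ _))
      (index_le.mp (le_max_right _ _))))
  · exact (hψ.lt_iff_lt (b := N + 1)).trans (Nat.lt_succ_iff.trans index_le)

end Filtration

section Monomials

variable {K A ι : Type*} [Field K] [CommRing A] [Algebra K A] [Fintype ι]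

/-- The monomial `x ^ m * ∏ i, g i ^ c i` with exponent `(m, c)`. -/
def monomialAt (x : A) (g : ι → A) (m : ℕ × (ι → ℕ)) : A := x ^ m.1 * ∏ i, g i ^ m.2 i

/-- The weight of an exponent `(m, c)`, where `x` has weight `e` and `g i` has weight `a i`. -/
def weight (e : ℕ) (a : ι → ℕ) (m : ℕ × (ι → ℕ)) : ℕ := m.1 * e + ∑ i, m.2 i * a i

variable (K) in
/-- The span of the monomials of weight less than `N`. The inequality is strict so that the
filtration starts with `⊥`. -/
def weightLT (x : A) (g : ι → A) (e : ℕ) (a : ι → ℕ) (N : ℕ) : Submodule K A :=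
  Submodule.span K (monomialAt x g '' {m | weight e a m < N})

/-- The exponents `(m, c)` with `c i < p i` for all `i`: the normal forms of a rewriting system
that rewrites `g i ^ p i`. -/
def Reduced (p : ι → ℕ) (m : ℕ × (ι → ℕ)) : Prop := ∀ i, m.2 i < p i

variable {x : A} {g : ι → A} {e : ℕ} {a p rk : ι → ℕ}

lemma monomialAt_zero : monomialAt x g 0 = 1 := by simp [monomialAt]

lemma monomialAt_add (m m' : ℕ × (ι → ℕ)) :
    monomialAt x g (m + m') = monomialAt x g m * monomialAt x g m' := by
  simp only [monomialAt, Prod.fst_add, Prod.snd_add, Pi.add_apply, pow_add, Finset.prod_mul_distrib]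
  ring

lemma monomialAt_fst (k : ℕ) : monomialAt x g (k, 0) = x ^ k := by simp [monomialAt]

lemma monomialAt_single [DecidableEq ι] (i : ι) (k : ℕ) :
    monomialAt x g (0, Pi.single i k) = g i ^ k := by
  simp [monomialAt, Pi.single_apply, pow_ite]

lemma weight_zero : weight e a 0 = 0 := by simp [weight]

lemma weight_add (m m' : ℕ × (ι → ℕ)) :
    weight e a (m + m') = weight e a m + weight e a m' := by
  simp only [weight, Prod.fst_add, Prod.snd_add, Pi.add_apply, add_mul, Finset.sum_add_distrib]
  ring

lemma weight_fst (k : ℕ) : weight e a (k, 0) = k * e := by simp [weight]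

lemma weight_single [DecidableEq ι] (i : ι) (k : ℕ) :
    weight e a (0, Pi.single i k) = k * a i := by
  simp [weight, Pi.single_apply]

lemma monomialAt_mem_weightLT {m : ℕ × (ι → ℕ)} {N : ℕ} (h : weight e a m < N) :
    monomialAt x g m ∈ weightLT K x g e a N :=
  Submodule.subset_span ⟨m, h, rfl⟩

lemma weightLT_mono : Monotone (weightLT K x g e a) := fun _ _ h =>
  Submodule.span_mono (Set.image_mono fun _ hm => lt_of_lt_of_le hm h)

lemma weightLT_zero : weightLT K x g e a 0 = ⊥ := by simp [weightLT]

lemma one_mem_weightLT_one : (1 : A) ∈ weightLT K x g e a 1 :=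
  monomialAt_zero (x := x) (g := g) ▸ monomialAt_mem_weightLT (by simp [weight_zero])

lemma mul_mem_weightLT {f f' : A} {N M : ℕ} (hf : f ∈ weightLT K x g e a (N + 1))
    (hf' : f' ∈ weightLT K x g e a M) : f * f' ∈ weightLT K x g e a (N + M) := by
  have hle : weightLT K x g e a (N + 1) * weightLT K x g e a M ≤ weightLT K x g e a (N + M) := by
    rw [weightLT, weightLT, Submodule.span_mul_span, Submodule.span_le]
    rintro _ ⟨_, ⟨m, hm, rfl⟩, _, ⟨m', hm', rfl⟩, rfl⟩
    rw [Set.mem_ofPred_eq] at hm hm'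
    refine (monomialAt_add (x := x) (g := g) m m').subst (motive := (· ∈ weightLT K x g e a _))
      (monomialAt_mem_weightLT ?_)
    rw [weight_add]
    omega
  exact hle (Submodule.mul_mem_mul hf hf')

lemma mul_monomialAt_mem_weightLT {f : A} {N : ℕ} (hf : f ∈ weightLT K x g e a N)
    (m : ℕ × (ι → ℕ)) : f * monomialAt x g m ∈ weightLT K x g e a (N + weight e a m) := by
  rw [mul_comm, add_comm]
  exact mul_mem_weightLT (monomialAt_mem_weightLT (Nat.lt_succ_self _)) hf

variable (K) in
/-- A rewriting rule for `g i`: the power `g i ^ p i` is, up to a nonzero constant and terms of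
smaller weight, a monomial of the same weight and of smaller rank. The rank of an exponent is its
weight when `x` is given rank `0` and `g i` rank `rk i`. -/
def HasRule (x : A) (g : ι → A) (e : ℕ) (a p rk : ι → ℕ) (i : ι) : Prop :=
  ∃ c : K, c ≠ 0 ∧ ∃ d : ℕ × (ι → ℕ), weight e a d = p i * a i ∧ weight 0 rk d < p i * rk i ∧
    g i ^ p i - c • monomialAt x g d ∈ weightLT K x g e a (p i * a i)

variable (K) in
/-- Rewriting rules for all generators `g i` of an algebra. The last two conditions say that the
weights of the reduced monomials without `x` represent every residue modulo `e` exactly once. -/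
structure RewriteSystem (x : A) (g : ι → A) (e : ℕ) (a p rk : ι → ℕ) : Prop where
  adjoin_eq_top : Algebra.adjoin K (insert x (Set.range g)) = ⊤
  hasRule (i : ι) : HasRule K x g e a p rk i
  residue_injective (c c' : ι → ℕ) : (∀ i, c i < p i) → (∀ i, c' i < p i) →
    ∑ i, c i * a i ≡ ∑ i, c' i * a i [MOD e] → c = c'
  prod_eq : ∏ i, p i = e

namespace RewriteSystem

lemma exists_mem_weightLT (h : RewriteSystem K x g e a p rk) (f : A) :
    ∃ N, f ∈ weightLT K x g e a N := by
  classical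
  have hf : f ∈ Algebra.adjoin K (insert x (Set.range g)) := by rw [h.adjoin_eq_top]; trivial
  induction hf using Algebra.adjoin_induction with
  | mem f hf =>
    obtain ⟨m, hm⟩ : ∃ m, monomialAt x g m = f := by
      obtain rfl | ⟨i, rfl⟩ := hf
      · exact ⟨(1, 0), by rw [monomialAt_fst, pow_one]⟩
      · exact ⟨(0, Pi.single i 1), by rw [monomialAt_single, pow_one]⟩
    exact ⟨_, hm ▸ monomialAt_mem_weightLT (Nat.lt_succ_self _)⟩
  | algebraMap c =>
    exact ⟨1, Algebra.algebraMap_eq_smul_one (A := A) c ▸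
      Submodule.smul_mem _ c one_mem_weightLT_one⟩
  | add f f' _ _ hf hf' =>
    obtain ⟨N, hN⟩ := hf
    obtain ⟨M, hM⟩ := hf'
    exact ⟨max N M, add_mem (weightLT_mono (le_max_left _ _) hN)
      (weightLT_mono (le_max_right _ _) hM)⟩
  | mul f f' _ _ hf hf' =>
    obtain ⟨N, hN⟩ := hf
    obtain ⟨M, hM⟩ := hf'
    exact ⟨N + M, mul_mem_weightLT (weightLT_mono (Nat.le_succ N) hN) hM⟩

/-- Apply the rules as long as possible; the rank decreases. -/
lemma exists_reduced (h : RewriteSystem K x g e a p rk) (m : ℕ × (ι → ℕ)) :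
    ∃ c : K, c ≠ 0 ∧ ∃ m', Reduced p m' ∧ weight e a m' = weight e a m ∧
      monomialAt x g m - c • monomialAt x g m' ∈ weightLT K x g e a (weight e a m) := by
  classical
  induction hk : weight 0 rk m using Nat.strong_induction_on generalizing m with
  | _ k ih =>
    by_cases hred : Reduced p m
    · exact ⟨1, one_ne_zero, m, hred, rfl, by simp⟩
    obtain ⟨i, hi⟩ : ∃ i, p i ≤ m.2 i := by simpa [Reduced] using hred
    obtain ⟨c, hc, d, hd, hrank, hrule⟩ := h.hasRule i
    obtain ⟨m₀, rfl⟩ : ∃ m₀, m = ((0, Pi.single i (p i)) : ℕ × (ι → ℕ)) + m₀ := by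
      refine ⟨(m.1, m.2 - Pi.single i (p i)), ?_⟩
      ext j
      · simp
      · obtain rfl | hj := eq_or_ne j i <;> simp [*]
    have hweight : weight e a (d + m₀) = weight e a ((0, Pi.single i (p i)) + m₀) := by
      rw [weight_add, weight_add, weight_single, hd]
    rw [weight_add, weight_single] at hk
    obtain ⟨c', hc', m', hm', hwm', hmem⟩ := ih _ (by rw [weight_add]; omega) (d + m₀) rfl
    refine ⟨c * c', mul_ne_zero hc hc', m', hm', hwm'.trans hweight, ?_⟩
    have hstep := mul_monomialAt_mem_weightLT hrule m₀
    rw [hweight, weight_add, weight_single] at hmem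
    rw [weight_add, weight_single, monomialAt_add, monomialAt_single]
    rw [monomialAt_add] at hmem
    convert add_mem hstep (Submodule.smul_mem _ c hmem) using 1
    simp only [Algebra.smul_def, map_mul]
    ring

lemma weightLT_le (h : RewriteSystem K x g e a p rk) (N : ℕ) :
    weightLT K x g e a N ≤
      Submodule.span K (monomialAt x g '' {m | Reduced p m ∧ weight e a m < N}) := by
  induction N with
  | zero => rw [weightLT_zero]; exact bot_le
  | succ N ih =>
    rw [weightLT, Submodule.span_le]
    rintro _ ⟨m, hm : weight e a m < N + 1, rfl⟩
    obtain ⟨c, -, m', hm', hw, hmem⟩ := h.exists_reduced m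
    have hlower : monomialAt x g m - c • monomialAt x g m' ∈
        Submodule.span K (monomialAt x g '' {m | Reduced p m ∧ weight e a m < N + 1}) := by
      refine Submodule.span_mono (Set.image_mono ?_) (ih (weightLT_mono (by omega) hmem))
      exact fun _ hm => ⟨hm.1, hm.2.trans N.lt_succ_self⟩
    have hlead : monomialAt x g m' ∈
        Submodule.span K (monomialAt x g '' {m | Reduced p m ∧ weight e a m < N + 1}) :=
      Submodule.subset_span ⟨m', ⟨hm', by omega⟩, rfl⟩
    exact (Submodule.sub_mem_iff_left _ (Submodule.smul_mem _ c hlead)).mp hlower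

lemma pos (h : RewriteSystem K x g e a p rk) : 0 < e := by
  obtain ⟨-, -, m, hm, -⟩ := h.exists_reduced 0
  rw [← h.prod_eq]
  exact Finset.prod_pos fun i _ => (Nat.zero_le _).trans_lt (hm i)

lemma reduced_ext (h : RewriteSystem K x g e a p rk) {m m' : ℕ × (ι → ℕ)}
    (hm : Reduced p m) (hm' : Reduced p m') (hw : weight e a m = weight e a m') : m = m' := by
  have hsnd : m.2 = m'.2 := by
    refine h.residue_injective _ _ hm hm' ?_
    have hmod : weight e a m % e = weight e a m' % e := by rw [hw]
    simpa [weight, Nat.ModEq] using hmod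
  refine Prod.ext (Nat.eq_of_mul_eq_mul_right h.pos ?_) hsnd
  simpa [weight, hsnd] using hw

lemma exists_sum_modEq (h : RewriteSystem K x g e a p rk) (k : ℕ) :
    ∃ c : ι → ℕ, (∀ i, c i < p i) ∧ ∑ i, c i * a i ≡ k [MOD e] := by
  classical
  have : NeZero e := ⟨h.pos.ne'⟩
  let residue (c : ∀ i, Fin (p i)) : ZMod e := (∑ i, c i * a i : ℕ)
  have hinj : Function.Injective residue := fun c c' hc => by
    have := h.residue_injective (fun i => c i) (fun i => c' i) (fun i => (c i).2)
      (fun i => (c' i).2) ((ZMod.natCast_eq_natCast_iff _ _ _).mp hc)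
    exact funext fun i => Fin.ext (congrFun this i)
  have hcard : Fintype.card (∀ i, Fin (p i)) = Fintype.card (ZMod e) := by
    simp [Fintype.card_pi, h.prod_eq, ZMod.card]
  obtain ⟨c, hc⟩ := ((Fintype.bijective_iff_injective_and_card _).mpr ⟨hinj, hcard⟩).2 (k : ZMod e)
  exact ⟨fun i => c i, fun i => (c i).2, (ZMod.natCast_eq_natCast_iff _ _ _).mp hc⟩

lemma linearIndependent [Algebra K[X] A] [IsScalarTower K K[X] A]
    (h : RewriteSystem K x g e a p rk) (hx : x = algebraMap K[X] A X)
    (hrank : Module.finrank K[X] A = e) :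
    LinearIndependent K (fun m : {m // Reduced p m} => monomialAt x g m.1) := by
  classical
  let b (c : ∀ i, Fin (p i)) : A := ∏ i, g i ^ (c i : ℕ)
  have hb (m) (hm : Reduced p m) :
      monomialAt x g m = (X ^ m.1 : K[X]) • b fun i => ⟨m.2 i, hm i⟩ := by
    simp only [monomialAt, b, Algebra.smul_def, map_pow, ← hx]
  have hspan : ⊤ ≤ Submodule.span K[X] (Set.range b) := by
    intro f _
    obtain ⟨N, hN⟩ := h.exists_mem_weightLT f
    refine (Submodule.span_le (p := (Submodule.span K[X] (Set.range b)).restrictScalars K)).mpr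
      ?_ (h.weightLT_le N hN)
    rintro _ ⟨m, ⟨hm, -⟩, rfl⟩
    rw [hb m hm]
    exact Submodule.smul_mem _ _ (Submodule.subset_span (Set.mem_range_self _))
  have hli : LinearIndependent K[X] b :=
    linearIndependent_of_top_le_span_of_card_eq_finrank hspan (by
      simp [hrank, ← h.prod_eq, Fintype.card_pi])
  let toPair : {m // Reduced p m} → ℕ × (∀ i, Fin (p i)) :=
    fun m => (m.1.1, fun i => ⟨m.1.2 i, m.2 i⟩)
  have htoPair : Function.Injective toPair := fun m m' heq => by
    simp only [toPair, Prod.mk.injEq] at heq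
    exact Subtype.ext (Prod.ext heq.1 (funext fun i => by simpa using congrFun heq.2 i))
  convert (linearIndependent_smul (Polynomial.basisMonomials K).linearIndependent hli).comp
    toPair htoPair using 1
  ext m
  simpa [toPair, ← Polynomial.X_pow_eq_monomial] using hb m.1 m.2

end RewriteSystem

end Monomials

section WeightValuation

variable {K A : Type*} [Field K] [CommRing A] [Algebra K A]

/-- A valuation on a `K`-algebra `A` that behaves like the pole order at a rational point outside
of which all elements of `A` are regular: nonzero elements have pole orders in `ℕ`, two elements
with the same pole order are proportional up to smaller pole order, and the powers of a fixed `x`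
with a pole, times finitely many elements of `A`, span the spaces of elements of bounded pole
order. The last condition normalizes `v` to have value group `ℤ`. -/
structure IsWeightValuation (K : Type*) {A : Type*} [Field K] [CommRing A] [Algebra K A] (x : A)
    (v : Valuation A ℤᵐ⁰) : Prop where
  exists_eq_exp {f : A} : f ≠ 0 → ∃ N : ℕ, v f = exp (N : ℤ)
  exists_sub_smul_lt {f g : A} : f ≠ 0 → v f = v g → ∃ c : K, v (f - c • g) < v f
  one_lt_map_x : 1 < v x
  exists_finite_span : ∃ B : Set A, B.Finite ∧ ∀ f,
    f ∈ Submodule.span K {z | ∃ m : ℕ, ∃ b ∈ B, z = x ^ m * b ∧ v z ≤ v f}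
  exists_consecutive : ∃ f g, f ≠ 0 ∧ v g = v f * exp 1

/-- The pole orders of the elements of `A`. -/
def poleNumbers (v : Valuation A ℤᵐ⁰) : Set ℕ := {N | ∃ f, v f = exp (N : ℤ)}

lemma valuation_eq_exp_iff {v : Valuation A ℤᵐ⁰} {f : A} {N : ℕ} :
    v f = exp (N : ℤ) ↔ v f < exp ((N + 1 : ℕ) : ℤ) ∧ ¬ v f < exp (N : ℤ) := by
  rw [Nat.cast_succ, exp_add, lt_mul_exp_iff_le exp_ne_zero, not_lt, le_antisymm_iff]

namespace RewriteSystem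

variable {ι : Type*} [Fintype ι] {x : A} {g : ι → A} {e : ℕ} {a p rk : ι → ℕ}

lemma monomialAt_notMem_weightLT (h : RewriteSystem K x g e a p rk)
    (hli : LinearIndependent K (fun m : {m // Reduced p m} => monomialAt x g m.1))
    (m : ℕ × (ι → ℕ)) : monomialAt x g m ∉ weightLT K x g e a (weight e a m) := by
  intro hmem
  obtain ⟨c, hc, m', hm', hw, hlower⟩ := h.exists_reduced m
  have hmem' : monomialAt x g m' ∈ weightLT K x g e a (weight e a m) :=
    (Submodule.smul_mem_iff _ hc).mp ((Submodule.sub_mem_iff_right _ hmem).mp hlower)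
  refine hli.notMem_span_image (s := {m' | weight e a m'.1 < weight e a m}) (x := ⟨m', hm'⟩)
    (by simp [hw]) (Submodule.span_mono ?_ (h.weightLT_le _ hmem'))
  rintro _ ⟨m₀, ⟨hm₀, hlt⟩, rfl⟩
  exact ⟨⟨m₀, hm₀⟩, hlt, rfl⟩

lemma exists_leading (h : RewriteSystem K x g e a p rk) {f : A} {N : ℕ}
    (hf : f ∈ weightLT K x g e a (N + 1)) (hf' : f ∉ weightLT K x g e a N) :
    ∃ m, Reduced p m ∧ weight e a m = N ∧ ∃ c : K, c ≠ 0 ∧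
      f - c • monomialAt x g m ∈ weightLT K x g e a N := by
  have hle : weightLT K x g e a (N + 1) ≤ weightLT K x g e a N ⊔
      Submodule.span K (monomialAt x g '' {m | Reduced p m ∧ weight e a m = N}) := by
    refine (h.weightLT_le _).trans (Submodule.span_le.mpr ?_)
    rintro _ ⟨m, ⟨hm, hlt⟩, rfl⟩
    obtain hlt | heq := Nat.lt_succ_iff_lt_or_eq.mp hlt
    · exact Submodule.mem_sup_left (monomialAt_mem_weightLT hlt)
    · exact Submodule.mem_sup_right (Submodule.subset_span ⟨m, ⟨hm, heq⟩, rfl⟩)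
  obtain ⟨m, hm, hw⟩ : ∃ m, Reduced p m ∧ weight e a m = N := by
    by_contra! hne
    have hempty : {m | Reduced p m ∧ weight e a m = N} = ∅ :=
      Set.eq_empty_of_forall_notMem fun m hm => hne m hm.1 hm.2
    simp only [hempty, Set.image_empty, Submodule.span_empty, sup_bot_eq] at hle
    exact hf' (hle hf)
  have hunique : {m | Reduced p m ∧ weight e a m = N} = {m} :=
    Set.eq_singleton_iff_unique_mem.mpr
      ⟨⟨hm, hw⟩, fun m' hm' => h.reduced_ext hm'.1 hm (hm'.2.trans hw.symm)⟩
  rw [hunique, Set.image_singleton] at hle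
  obtain ⟨f', hlower, _, hlead, rfl⟩ := Submodule.mem_sup.mp (hle hf)
  obtain ⟨c, rfl⟩ := Submodule.mem_span_singleton.mp hlead
  refine ⟨m, hm, hw, c, fun hc => hf' ?_, by rwa [add_sub_cancel_right]⟩
  rwa [hc, zero_smul, add_zero]

lemma mul_notMem_weightLT (h : RewriteSystem K x g e a p rk)
    (hli : LinearIndependent K (fun m : {m // Reduced p m} => monomialAt x g m.1))
    {N M : ℕ} {f f' : A} (hf₁ : f ∈ weightLT K x g e a (N + 1)) (hf₀ : f ∉ weightLT K x g e a N)
    (hf'₁ : f' ∈ weightLT K x g e a (M + 1)) (hf'₀ : f' ∉ weightLT K x g e a M) :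
    f * f' ∉ weightLT K x g e a (N + M) := by
  intro hmem
  obtain ⟨m, -, rfl, c, hc, hlower⟩ := h.exists_leading hf₁ hf₀
  obtain ⟨m', -, rfl, c', hc', hlower'⟩ := h.exists_leading hf'₁ hf'₀
  apply h.monomialAt_notMem_weightLT hli (m + m')
  rw [weight_add, ← Submodule.smul_mem_iff _ (mul_ne_zero hc hc')]
  have hleft := Submodule.smul_mem _ c' (mul_monomialAt_mem_weightLT hlower m')
  have hright := mul_mem_weightLT hf₁ hlower'
  convert sub_mem (sub_mem hmem hright) hleft using 1
  rw [monomialAt_add]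
  simp only [Algebra.smul_def, map_mul]
  ring

lemma exists_valuation [Nontrivial A] (h : RewriteSystem K x g e a p rk)
    (hli : LinearIndependent K (fun m : {m // Reduced p m} => monomialAt x g m.1)) :
    ∃ v : Valuation A ℤᵐ⁰, ∀ f (N : ℕ), v f < exp (N : ℤ) ↔ f ∈ weightLT K x g e a N := by
  refine exists_valuation_of_filtration (fun N => (weightLT K x g e a N).toAddSubgroup)
    (fun _ _ hNM => weightLT_mono hNM) ?_ one_mem_weightLT_one h.exists_mem_weightLT
    fun N M f f' hf₁ hf₀ hf'₁ hf'₀ =>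
      ⟨mul_mem_weightLT (N := N) (M := M + 1) hf₁ hf'₁,
        h.mul_notMem_weightLT hli hf₁ hf₀ hf'₁ hf'₀⟩
  rw [weightLT_zero]
  rfl

section

variable {v : Valuation A ℤᵐ⁰}

lemma exists_eq_exp (h : RewriteSystem K x g e a p rk)
    (hv : ∀ f (N : ℕ), v f < exp (N : ℤ) ↔ f ∈ weightLT K x g e a N) {f : A} (hf : f ≠ 0) :
    ∃ N : ℕ, v f = exp (N : ℤ) := by
  classical
  have hex := h.exists_mem_weightLT f
  have hpos : Nat.find hex ≠ 0 := fun h0 => hf (by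
    simpa [h0, weightLT_zero] using Nat.find_spec hex)
  obtain ⟨N, hN⟩ := Nat.exists_eq_succ_of_ne_zero hpos
  refine ⟨N, valuation_eq_exp_iff.mpr ?_⟩
  rw [hv, hv]
  exact ⟨by simpa [hN] using Nat.find_spec hex, Nat.find_min hex (by omega)⟩

lemma valuation_monomialAt (h : RewriteSystem K x g e a p rk)
    (hli : LinearIndependent K (fun m : {m // Reduced p m} => monomialAt x g m.1))
    (hv : ∀ f (N : ℕ), v f < exp (N : ℤ) ↔ f ∈ weightLT K x g e a N) (m : ℕ × (ι → ℕ)) :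
    v (monomialAt x g m) = exp (weight e a m : ℤ) := by
  rw [valuation_eq_exp_iff, hv, hv]
  exact ⟨monomialAt_mem_weightLT (Nat.lt_succ_self _), h.monomialAt_notMem_weightLT hli m⟩

lemma exists_sub_smul_lt (h : RewriteSystem K x g e a p rk)
    (hv : ∀ f (N : ℕ), v f < exp (N : ℤ) ↔ f ∈ weightLT K x g e a N) {f f' : A} (hf : f ≠ 0)
    (hff' : v f = v f') : ∃ c : K, v (f - c • f') < v f := by
  obtain ⟨N, hN⟩ := h.exists_eq_exp hv hf
  have hN' := hff' ▸ hN
  rw [valuation_eq_exp_iff, hv, hv] at hN'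
  rw [hN]
  rw [valuation_eq_exp_iff, hv, hv] at hN
  obtain ⟨m, hm, hw, c, -, hlt⟩ := h.exists_leading hN.1 hN.2
  obtain ⟨m', hm', hw', c', hc', hlt'⟩ := h.exists_leading hN'.1 hN'.2
  obtain rfl := h.reduced_ext hm hm' (hw.trans hw'.symm)
  refine ⟨c / c', (hv _ _).mpr ?_⟩
  convert sub_mem hlt (Submodule.smul_mem _ (c / c') hlt') using 1
  rw [smul_sub, smul_smul, div_mul_cancel₀ _ hc']
  abel

lemma exists_finite_span (h : RewriteSystem K x g e a p rk)
    (hli : LinearIndependent K (fun m : {m // Reduced p m} => monomialAt x g m.1))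
    (hv : ∀ f (N : ℕ), v f < exp (N : ℤ) ↔ f ∈ weightLT K x g e a N) :
    ∃ B : Set A, B.Finite ∧ ∀ f,
      f ∈ Submodule.span K {z | ∃ m : ℕ, ∃ b ∈ B, z = x ^ m * b ∧ v z ≤ v f} := by
  refine ⟨Set.range fun c : ∀ i, Fin (p i) => ∏ i, g i ^ (c i : ℕ), Set.finite_range _,
    fun f => ?_⟩
  obtain rfl | hf := eq_or_ne f 0
  · exact zero_mem _
  obtain ⟨N, hN⟩ := h.exists_eq_exp hv hf
  have hmem := ((hv _ _).mp (valuation_eq_exp_iff.mp hN).1)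
  refine Submodule.span_mono ?_ (h.weightLT_le _ hmem)
  rintro _ ⟨m, ⟨hm, hlt⟩, rfl⟩
  refine ⟨m.1, _, ⟨fun i => ⟨m.2 i, hm i⟩, rfl⟩, rfl, ?_⟩
  rw [hN, h.valuation_monomialAt hli hv, exp_le_exp]
  exact_mod_cast Nat.lt_succ_iff.mp hlt

lemma exists_consecutive (h : RewriteSystem K x g e a p rk)
    (hli : LinearIndependent K (fun m : {m // Reduced p m} => monomialAt x g m.1))
    (hv : ∀ f (N : ℕ), v f < exp (N : ℤ) ↔ f ∈ weightLT K x g e a N) :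
    ∃ f f', f ≠ 0 ∧ v f' = v f * exp 1 := by
  obtain ⟨c, -, hc⟩ := h.exists_sum_modEq 1
  have hmod : 1 ≡ weight e a (1, c) [MOD e] := by simpa [weight, Nat.ModEq] using hc.symm
  have hle : 1 ≤ weight e a (1, c) := by
    rw [weight, one_mul]
    exact le_add_right h.pos
  obtain ⟨k, hk⟩ := (Nat.modEq_iff_dvd' hle).mp hmod
  have hw : weight e a (1, c) = weight e a (k, 0) + 1 := by
    rw [weight_fst, mul_comm, ← hk, Nat.sub_add_cancel hle]
  have hval := h.valuation_monomialAt hli hv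
  refine ⟨monomialAt x g (k, 0), monomialAt x g (1, c), fun h0 => ?_, ?_⟩
  · have := hval (k, 0)
    rw [h0, map_zero] at this
    exact exp_ne_zero this.symm
  · rw [hval, hval, hw, Nat.cast_succ, exp_add]

end

theorem exists_isWeightValuation [Nontrivial A] (h : RewriteSystem K x g e a p rk)
    (hli : LinearIndependent K (fun m : {m // Reduced p m} => monomialAt x g m.1)) :
    ∃ v, IsWeightValuation K x v ∧ poleNumbers v = Set.range (weight e a) ∧
      ∀ m, v (monomialAt x g m) = exp (weight e a m : ℤ) := by
  obtain ⟨v, hv⟩ := h.exists_valuation hli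
  have hval := h.valuation_monomialAt hli hv
  refine ⟨v, ⟨h.exists_eq_exp hv, h.exists_sub_smul_lt hv, ?_, h.exists_finite_span hli hv,
    h.exists_consecutive hli hv⟩, Set.Subset.antisymm ?_ ?_, hval⟩
  · rw [← pow_one x, ← monomialAt_fst (g := g), hval, weight_fst, ← exp_zero, exp_lt_exp]
    exact_mod_cast one_mul e ▸ h.pos
  · rintro N ⟨f, hf⟩
    have hmem := valuation_eq_exp_iff.mp hf
    rw [hv, hv] at hmem
    obtain ⟨m, -, hm, -⟩ := h.exists_leading hmem.1 hmem.2
    exact ⟨m, hm⟩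
  · rintro _ ⟨m, rfl⟩
    exact ⟨_, hval m⟩

end RewriteSystem

namespace IsWeightValuation

variable {x : A} {v : Valuation A ℤᵐ⁰}

lemma ne_zero (h : IsWeightValuation K x v) {f : A} (hf : f ≠ 0) : v f ≠ 0 := by
  obtain ⟨N, hN⟩ := h.exists_eq_exp hf
  exact hN ▸ exp_ne_zero

lemma isDomain [Nontrivial A] (h : IsWeightValuation K x v) : IsDomain A := by
  have : NoZeroDivisors A := ⟨fun {a b} hab => by
    by_contra! hne
    have hv := congrArg v hab
    rw [map_mul, map_zero, mul_eq_zero] at hv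
    exact hv.elim (h.ne_zero hne.1) (h.ne_zero hne.2)⟩
  exact NoZeroDivisors.to_isDomain A

lemma one_le (h : IsWeightValuation K x v) {f : A} (hf : f ≠ 0) : 1 ≤ v f := by
  obtain ⟨N, hN⟩ := h.exists_eq_exp hf
  rw [hN, ← exp_zero, exp_le_exp]
  exact Int.natCast_nonneg N

lemma map_algebraMap [Nontrivial A] (h : IsWeightValuation K x v) {c : K} (hc : c ≠ 0) :
    v (algebraMap K A c) = 1 := by
  have hone_le {d : K} (hd : d ≠ 0) : 1 ≤ v (algebraMap K A d) :=
    h.one_le ((map_ne_zero_iff _ (algebraMap K A).injective).mpr hd)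
  refine le_antisymm ?_ (hone_le hc)
  calc v (algebraMap K A c) ≤ v (algebraMap K A c) * v (algebraMap K A c⁻¹) :=
        le_mul_of_one_le_right' (hone_le (inv_ne_zero hc))
    _ = 1 := by rw [← map_mul, ← map_mul, mul_inv_cancel₀ hc, map_one, map_one]

lemma ker_ne_bot [Nontrivial A] (h : IsWeightValuation K x v) (φ : A →ₐ[K] K) :
    RingHom.ker φ ≠ ⊥ := by
  intro hbot
  have hmem : x - algebraMap K A (φ x) ∈ RingHom.ker φ := by simp [RingHom.mem_ker]
  rw [hbot, Ideal.mem_bot, sub_eq_zero] at hmem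
  have hlt := h.one_lt_map_x
  rw [hmem] at hlt
  obtain hc | hc := eq_or_ne (φ x) 0
  · simp [hc] at hlt
  · exact hlt.ne' (h.map_algebraMap hc)

end IsWeightValuation

end WeightValuation

section Places

variable {K F : Type*} [Field K] [Field F]

lemma le_exp_neg_one_iff {z : ℤᵐ⁰} : z ≤ exp (-1) ↔ z < 1 := by
  rw [← lt_mul_exp_iff_le exp_ne_zero, ← exp_add, neg_add_cancel, exp_zero]

lemma valuation_eq_of_isEquiv {v w : Valuation F ℤᵐ⁰} (h : v.IsEquiv w)
    (hv : ∃ f, v f = exp (-1)) (hw : ∃ f, w f = exp (-1)) : v = w := by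
  obtain ⟨π, hπ⟩ := hv
  obtain ⟨π', hπ'⟩ := hw
  have hwπ : w π = exp (-1) := by
    refine le_antisymm (le_exp_neg_one_iff.mpr ?_) ?_
    · exact h.lt_one_iff_lt_one.mp (le_exp_neg_one_iff.mp hπ.le)
    · rw [← hπ', ← h, hπ, le_exp_neg_one_iff]
      exact h.lt_one_iff_lt_one.mpr (le_exp_neg_one_iff.mp hπ'.le)
  ext f
  obtain rfl | hf := eq_or_ne f 0
  · rw [map_zero, map_zero]
  obtain ⟨k, hk⟩ : ∃ k, v f = exp k := ⟨_, (exp_log (v.ne_zero_iff.mpr hf)).symm⟩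
  have hpow : v f = v (π ^ (-k)) := by
    rw [hk, map_zpow₀, hπ, ← exp_zsmul, smul_neg, zsmul_one, Int.cast_id, neg_neg]
  rw [hpow, h.eq_iff.mp hpow, map_zpow₀, map_zpow₀, hπ, hwπ]

namespace Place

variable [Algebra K F]

lemma valuation_le_one_iff (P : Place K F) (f : F) : P.valuation f ≤ 1 ↔ f ∈ P.ring := by
  have := P.isDVR
  refine ⟨fun hf => ?_, fun hf => ?_⟩
  · obtain ⟨f', rfl⟩ := IsDiscreteValuationRing.exists_lift_of_le_one hf
    exact f'.2
  · exact (IsDiscreteValuationRing.maximalIdeal P.ring).valuation_le_one (K := F) ⟨f, hf⟩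

lemma exists_valuation_eq_exp_neg_one (P : Place K F) : ∃ f, P.valuation f = exp (-1) :=
  have := P.isDVR
  (IsDiscreteValuationRing.maximalIdeal P.ring).valuation_exists_uniformizer F

lemma poleOrder_eq_zero_iff (P : Place K F) {f : F} (hf : f ≠ 0) :
    P.poleOrder f = 0 ↔ f ∈ P.ring := by
  rw [← valuation_le_one_iff, poleOrder, ord, neg_neg, Int.toNat_eq_zero, ← log_one,
    log_le_log (P.valuation.ne_zero_iff.mpr hf) one_ne_zero]

lemma poleOrder_eq (P : Place K F) {f : F} {N : ℕ} (h : P.valuation f = exp (N : ℤ)) :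
    P.poleOrder f = N := by
  rw [poleOrder, ord, h, log_exp, neg_neg, Int.toNat_natCast]

lemma eq_of_ring_le {P Q : Place K F} (h : P.ring ≤ Q.ring) : P = Q := by
  have := P.isDVR
  have htop : Q.ring ≠ ⊤ := by
    rintro htop
    obtain ⟨π, hπ⟩ := Q.exists_valuation_eq_exp_neg_one
    have hinv : Q.valuation π⁻¹ ≤ 1 := (Q.valuation_le_one_iff _).mpr (htop ▸ trivial)
    rw [map_inv₀, hπ, ← exp_neg, ← exp_zero, exp_le_exp] at hinv
    norm_num at hinv
  have hring := ValuationSubring.eq_of_le_of_ne_top _ h htop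
  cases P
  cases Q
  cases hring
  rfl

lemma valuation_algebraMap (P : Place K F) {c : K} (hc : c ≠ 0) :
    P.valuation (algebraMap K F c) = 1 := by
  have hle (d : K) : P.valuation (algebraMap K F d) ≤ 1 :=
    (P.valuation_le_one_iff _).mpr (P.algebraMap_mem d)
  have hinv := hle c⁻¹
  rw [map_inv₀, map_inv₀, inv_le_one₀ (zero_lt_iff.mpr (by simpa using hc))] at hinv
  exact le_antisymm (hle c) hinv

lemma isRational_iff (P : Place K F) :
    P.IsRational ↔ ∀ f ∈ P.ring, ∃ c : K, P.valuation (f - algebraMap K F c) < 1 := by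
  have := P.isDVR
  have hresidue (f : P.ring) (c : K) : IsLocalRing.residue P.ring (P.constants c) =
      IsLocalRing.residue P.ring f ↔ P.valuation ((f : F) - algebraMap K F c) < 1 := by
    rw [eq_comm, ← sub_eq_zero, ← map_sub, IsLocalRing.residue_eq_zero_iff]
    exact ((IsDiscreteValuationRing.maximalIdeal P.ring).valuation_lt_one_iff_mem (K := F) _).symm
  simp only [IsRational, Function.Surjective, IsLocalRing.residue_surjective.forall,
    RingHom.comp_apply, hresidue, Subtype.forall]

/-- The place whose valuation is a given surjective valuation `F → ℤᵐ⁰` that is trivial on the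
constants. -/
def ofValuation (v : Valuation F ℤᵐ⁰) (hv : ∃ f, v f = exp (-1))
    (hK : ∀ c : K, v (algebraMap K F c) ≤ 1) : Place K F where
  ring := v.valuationSubring
  isDVR := by
    have : Nontrivial (MonoidWithZeroHom.valueGroup (.ofClass v)) := by
      obtain ⟨π, hπ⟩ := hv
      rw [Subgroup.nontrivial_iff_exists_ne_one]
      refine ⟨Units.mk0 (v π) (by simp [hπ]),
        MonoidWithZeroHom.mem_valueGroup _ ⟨π, by simp⟩, fun hone => ?_⟩
      simpa [hπ] using congrArg Units.val hone
    infer_instance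
  algebraMap_mem := hK

lemma valuation_ofValuation (v : Valuation F ℤᵐ⁰) (hv : ∃ f, v f = exp (-1))
    (hK : ∀ c : K, v (algebraMap K F c) ≤ 1) : (ofValuation v hv hK).valuation = v :=
  valuation_eq_of_isEquiv (Valuation.isEquiv_of_val_le_one fun {f} => valuation_le_one_iff _ f)
    (exists_valuation_eq_exp_neg_one _) hv

end Place

end Places

section PlaceAtInfinity

lemma Place.algebraMap_mem_of_isIntegralElem {K A F : Type*} [Field K] [CommRing A] [Field F]
    [Algebra K A] [Algebra A F] [Algebra K F] [IsScalarTower K A F] (Q : Place K F) {x f : A}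
    (hx : algebraMap A F x ∈ Q.ring) (hf : (aeval (R := K) x).IsIntegralElem f) :
    algebraMap A F f ∈ Q.ring := by
  obtain ⟨P, hP, hroot⟩ := hf
  let φ : K[X] →+* Q.ring := eval₂RingHom Q.constants ⟨algebraMap A F x, hx⟩
  have hφ : (algebraMap Q.ring F).comp φ = (algebraMap A F).comp (aeval (R := K) x).toRingHom :=
    ringHom_ext
      (fun c => by simpa [φ, Place.constants] using IsScalarTower.algebraMap_apply K A F c)
      (by simp [φ])
  have hint : IsIntegral Q.ring (algebraMap A F f) := by
    refine ⟨P.map φ, hP.map φ, ?_⟩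
    rw [eval₂_map, hφ, ← hom_eval₂, hroot, map_zero]
  obtain ⟨f', hf'⟩ := IsIntegrallyClosed.isIntegral_iff.mp hint
  exact hf' ▸ f'.2

namespace IsWeightValuation

section

variable {K A F : Type*} [Field K] [CommRing A] [Algebra K A] {x : A}
  {v : Valuation A ℤᵐ⁰} [Field F] [Algebra A F] [Algebra K F] [IsScalarTower K A F]

lemma exists_valuation_le_mul_pow (h : IsWeightValuation K x v) {Q : Place K F}
    (hQ : 1 < Q.valuation (algebraMap A F x)) :
    ∃ M, ∀ f b, v f ≤ v x ^ b →
      Q.valuation (algebraMap A F f) ≤ M * Q.valuation (algebraMap A F x) ^ b := by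
  obtain ⟨B, hB, hspan⟩ := h.exists_finite_span
  obtain ⟨M, hM⟩ := (hB.image fun β => Q.valuation (algebraMap A F β)).bddAbove
  refine ⟨M, fun f b hf => ?_⟩
  refine Submodule.span_induction (p := fun z _ => Q.valuation (algebraMap A F z) ≤
    M * Q.valuation (algebraMap A F x) ^ b) ?_ ?_ ?_ ?_ (hspan f)
  · rintro _ ⟨m, β, hβ, rfl, hle⟩
    obtain rfl | hβ0 := eq_or_ne β 0
    · rw [mul_zero, map_zero, map_zero]
      exact zero_le
    have hmb : m ≤ b := (pow_le_pow_iff_right₀ h.one_lt_map_x).mp <|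
      calc v x ^ m ≤ v x ^ m * v β := le_mul_of_one_le_right' (h.one_le hβ0)
        _ = v (x ^ m * β) := by rw [map_mul, map_pow]
        _ ≤ v x ^ b := hle.trans hf
    rw [map_mul, map_mul, map_pow, map_pow, mul_comm]
    exact mul_le_mul' (hM ⟨β, hβ, rfl⟩) (pow_le_pow_right₀ hQ.le hmb)
  · rw [map_zero, map_zero]
    exact zero_le
  · intro f g _ _ hf hg
    rw [map_add]
    exact Q.valuation.map_add_le hf hg
  · intro c f _ hf
    rw [Algebra.smul_def, map_mul, map_mul, ← IsScalarTower.algebraMap_apply]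
    refine (mul_le_of_le_one_left zero_le ?_).trans hf
    exact (Q.valuation_le_one_iff _).mpr (Q.algebraMap_mem c)

/- Applied to the powers of `f`, the previous bound holds with `M = 1`, since `ℤᵐ⁰` is
archimedean. -/
lemma valuation_le_pow (h : IsWeightValuation K x v) {Q : Place K F}
    (hQ : 1 < Q.valuation (algebraMap A F x)) {f : A} {b : ℕ} (hf : v f ≤ v x ^ b) :
    Q.valuation (algebraMap A F f) ≤ Q.valuation (algebraMap A F x) ^ b := by
  obtain ⟨M, hM⟩ := h.exists_valuation_le_mul_pow hQ
  have hpos : 0 < Q.valuation (algebraMap A F x) ^ b := pow_pos (zero_lt_one.trans hQ) b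
  by_contra! hlt
  have hone := (one_lt_div₀ hpos).mpr hlt
  obtain ⟨k, hk⟩ := MulArchimedean.arch M hone
  have hle := hM (f ^ (k + 1)) (b * (k + 1)) (by
    rw [map_pow, pow_mul]
    exact pow_le_pow_left₀ zero_le hf _)
  rw [map_pow, map_pow, pow_mul, ← div_le_iff₀ (pow_pos hpos _), ← div_pow] at hle
  exact (hle.trans hk).not_gt (pow_lt_pow_right₀ hone k.lt_succ_self)

lemma valuation_lt_pow (h : IsWeightValuation K x v) {Q : Place K F}
    (hQ : 1 < Q.valuation (algebraMap A F x)) {f : A} {b : ℕ} (hf : v f < v x ^ b) :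
    Q.valuation (algebraMap A F f) < Q.valuation (algebraMap A F x) ^ b := by
  have hpos : 0 < Q.valuation (algebraMap A F x) ^ b := pow_pos (zero_lt_one.trans hQ) b
  obtain rfl | hf0 := eq_or_ne f 0
  · rwa [map_zero, map_zero]
  have hvf : 0 < v f := zero_lt_iff.mpr (h.ne_zero hf0)
  obtain ⟨k, hk⟩ := MulArchimedean.arch (v x) ((one_lt_div₀ hvf).mpr hf)
  rw [div_pow, le_div_iff₀ (pow_pos hvf k), ← pow_mul, ← map_pow, ← map_mul] at hk
  have hle := h.valuation_le_pow hQ hk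
  rw [map_mul, map_mul, map_pow, map_pow, pow_mul] at hle
  by_contra! hge
  refine (hle.trans (pow_le_pow_left₀ zero_le hge k)).not_gt ?_
  exact lt_mul_of_one_lt_left (pow_pos (hpos.trans_le hge) k) hQ

lemma valuation_eq_pow (h : IsWeightValuation K x v) {Q : Place K F}
    (hQ : 1 < Q.valuation (algebraMap A F x)) {f : A} {b : ℕ} (hf : v f = v x ^ b) :
    Q.valuation (algebraMap A F f) = Q.valuation (algebraMap A F x) ^ b := by
  have hvx : v x ^ b ≠ 0 := pow_ne_zero b (zero_lt_one.trans h.one_lt_map_x).ne'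
  have hf0 : f ≠ 0 := by
    rintro rfl
    exact hvx (by rw [← hf, map_zero])
  obtain ⟨c, hc⟩ := h.exists_sub_smul_lt (g := x ^ b) hf0 (by rw [hf, map_pow])
  have hc0 : c ≠ 0 := by
    rintro rfl
    exact hc.ne (by rw [zero_smul, sub_zero])
  have hlead : Q.valuation (algebraMap A F (c • x ^ b)) = Q.valuation (algebraMap A F x) ^ b := by
    rw [Algebra.smul_def, map_mul, map_mul, ← IsScalarTower.algebraMap_apply,
      Q.valuation_algebraMap hc0, one_mul, map_pow, map_pow]
  have hlower := h.valuation_lt_pow hQ (hc.trans_eq hf)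
  rw [← hlead] at hlower ⊢
  rw [← sub_add_cancel f (c • x ^ b), map_add]
  exact Valuation.map_add_eq_of_lt_right _ hlower

end

variable {K A : Type*} [Field K] [CommRing A] [IsDomain A] [Algebra K A] {x : A}
  {v : Valuation A ℤᵐ⁰} (F : Type*) [Field F] [Algebra A F] [IsFractionRing A F]

/-- The extension of a weight valuation to the field of fractions. -/
noncomputable def extend (h : IsWeightValuation K x v) : Valuation F ℤᵐ⁰ :=
  v.extendToLocalization (S := nonZeroDivisors A)
    (fun _ hf hf' => h.ne_zero (nonZeroDivisors.ne_zero hf) hf') F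

@[simp]
lemma extend_algebraMap (h : IsWeightValuation K x v) (f : A) :
    h.extend F (algebraMap A F f) = v f :=
  Valuation.extendToLocalization_apply_map_apply _ _ _ _

variable [Algebra K F] [IsScalarTower K A F]

/-- The place at infinity of a weight valuation: its valuation is the given one, so that `x` has
a pole there. -/
noncomputable def place (h : IsWeightValuation K x v) : Place K F :=
  Place.ofValuation (h.extend F)
    (by
      obtain ⟨f, g, hf, hfg⟩ := h.exists_consecutive
      refine ⟨algebraMap A F f / algebraMap A F g, ?_⟩
      rw [map_div₀, extend_algebraMap, extend_algebraMap, hfg, div_mul_cancel_left₀ (h.ne_zero hf),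
        exp_neg])
    (fun c => by
      rw [IsScalarTower.algebraMap_apply K A F, extend_algebraMap]
      obtain rfl | hc := eq_or_ne c 0
      · simp
      · exact (h.map_algebraMap hc).le)

variable {F}

lemma place_valuation_algebraMap (h : IsWeightValuation K x v) (f : A) :
    (h.place F).valuation (algebraMap A F f) = v f := by
  rw [place, Place.valuation_ofValuation, extend_algebraMap]

lemma algebraMap_notMem_place (h : IsWeightValuation K x v) :
    algebraMap A F x ∉ (h.place F).ring := by
  rw [← Place.valuation_le_one_iff, place_valuation_algebraMap, not_le]
  exact h.one_lt_map_x

lemma place_isRational (h : IsWeightValuation K x v) : (h.place F).IsRational := by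
  rw [Place.isRational_iff]
  intro z hz
  obtain hlt | heq := ((Place.valuation_le_one_iff _ _).mpr hz).lt_or_eq
  · exact ⟨0, by rwa [map_zero, sub_zero]⟩
  obtain ⟨f, g, hg, rfl⟩ := IsFractionRing.div_surjective A z
  have hg : g ≠ 0 := nonZeroDivisors.ne_zero hg
  have hg' : algebraMap A F g ≠ 0 := by simpa using hg
  rw [map_div₀, place_valuation_algebraMap, place_valuation_algebraMap,
    div_eq_one_iff_eq (h.ne_zero hg)] at heq
  have hf : f ≠ 0 := by
    rintro rfl
    exact h.ne_zero hg (by rw [← heq, map_zero])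
  obtain ⟨c, hc⟩ := h.exists_sub_smul_lt hf heq
  have hsub : algebraMap A F f / algebraMap A F g - algebraMap K F c =
      algebraMap A F (f - c • g) / algebraMap A F g := by
    rw [Algebra.smul_def, map_sub, map_mul, ← IsScalarTower.algebraMap_apply, sub_div,
      mul_div_cancel_right₀ _ hg']
  refine ⟨c, ?_⟩
  rwa [hsub, map_div₀, place_valuation_algebraMap, place_valuation_algebraMap,
    div_lt_one₀ (zero_lt_iff.mpr (h.ne_zero hg)), ← heq]

theorem eq_place (h : IsWeightValuation K x v) {Q : Place K F} (hQ : algebraMap A F x ∉ Q.ring) :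
    Q = h.place F := by
  rw [← Place.valuation_le_one_iff, not_le] at hQ
  obtain ⟨e, he⟩ := h.exists_eq_exp (f := x) (fun h0 => by
    simpa [h0] using h.one_lt_map_x)
  have he0 : e ≠ 0 := by
    rintro rfl
    exact h.one_lt_map_x.ne (by rw [he, Nat.cast_zero, exp_zero])
  have hpow {f : A} {N : ℕ} (hN : v f = exp (N : ℤ)) :
      Q.valuation (algebraMap A F f) ^ e = Q.valuation (algebraMap A F x) ^ N := by
    rw [← map_pow, ← map_pow]
    refine h.valuation_eq_pow hQ ?_
    rw [map_pow, hN, he, ← exp_nsmul, ← exp_nsmul, nsmul_eq_mul, nsmul_eq_mul, mul_comm]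
  refine (Place.eq_of_ring_le fun z hz => ?_).symm
  rw [← Place.valuation_le_one_iff] at hz ⊢
  obtain ⟨f, g, hg, rfl⟩ := IsFractionRing.div_surjective A z
  have hg0 : g ≠ 0 := nonZeroDivisors.ne_zero hg
  obtain rfl | hf0 := eq_or_ne f 0
  · simp
  obtain ⟨N, hN⟩ := h.exists_eq_exp hf0
  obtain ⟨M, hM⟩ := h.exists_eq_exp hg0
  rw [map_div₀, place_valuation_algebraMap, place_valuation_algebraMap,
    div_le_one₀ (zero_lt_iff.mpr (h.ne_zero hg0)), hN, hM, exp_le_exp] at hz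
  rw [map_div₀, div_le_one₀ (zero_lt_iff.mpr (Q.valuation.ne_zero_iff.mpr (by simpa using hg0)))]
  refine le_of_pow_le_pow_left₀ he0 zero_le ?_
  rw [hpow hN, hpow hM]
  exact pow_le_pow_right₀ hQ.le (by exact_mod_cast hz)

lemma algebraMap_mem_of_ne_place (h : IsWeightValuation K x v)
    (hx : (aeval (R := K) x).IsIntegral) {Q : Place K F} (hQ : Q ≠ h.place F) (f : A) :
    algebraMap A F f ∈ Q.ring :=
  Q.algebraMap_mem_of_isIntegralElem (not_imp_comm.mp h.eq_place hQ) (hx f)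

end IsWeightValuation

end PlaceAtInfinity

section RationalPlaces

namespace Place

variable {K A F : Type*} [Field K] [CommRing A] [Field F] [Algebra K A] [Algebra A F]
  [Algebra K F] [IsScalarTower K A F]

lemma exists_algHom {Q : Place K F} (hQ : Q.IsRational) (hA : ∀ f : A, algebraMap A F f ∈ Q.ring) :
    ∃ φ : A →ₐ[K] K, ∀ f, φ f = 0 ↔ Q.valuation (algebraMap A F f) < 1 := by
  have := Q.isDVR
  let κ := RingEquiv.ofBijective _ ⟨RingHom.injective _, hQ⟩
  let res := (IsLocalRing.residue Q.ring).comp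
    ((algebraMap A F).codRestrict Q.ring.toSubring hA)
  refine ⟨⟨κ.symm.toRingHom.comp res, fun c => κ.symm_apply_eq.mpr <|
    congrArg (IsLocalRing.residue Q.ring)
      (Subtype.ext (IsScalarTower.algebraMap_apply K A F c).symm)⟩, fun f => ?_⟩
  calc κ.symm (res f) = 0 ↔ res f = 0 := by rw [κ.symm_apply_eq, map_zero]
    _ ↔ Q.valuation (algebraMap A F f) < 1 :=
      (IsLocalRing.residue_eq_zero_iff _).trans
        ((IsDiscreteValuationRing.maximalIdeal Q.ring).valuation_lt_one_iff_mem (K := F)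
          ⟨algebraMap A F f, hA f⟩).symm

variable [IsDedekindDomain A] [IsFractionRing A F]

/-- The place of a maximal ideal of a Dedekind domain. -/
noncomputable def ofPrime (P : IsDedekindDomain.HeightOneSpectrum A) : Place K F :=
  ofValuation (P.valuation F) (P.valuation_exists_uniformizer F) fun c => by
    rw [IsScalarTower.algebraMap_apply K A F]
    exact P.valuation_le_one _

lemma valuation_ofPrime (P : IsDedekindDomain.HeightOneSpectrum A) :
    (ofPrime P : Place K F).valuation = P.valuation F :=
  valuation_ofValuation _ _ _

lemma algebraMap_mem_ofPrime (P : IsDedekindDomain.HeightOneSpectrum A) (f : A) :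
    algebraMap A F f ∈ (ofPrime P : Place K F).ring := by
  rw [← valuation_le_one_iff, valuation_ofPrime]
  exact P.valuation_le_one f

lemma valuation_ofPrime_eq_one {P : IsDedekindDomain.HeightOneSpectrum A} {f : A}
    (hf : f ∉ P.asIdeal) : (ofPrime P : Place K F).valuation (algebraMap A F f) = 1 := by
  rw [valuation_ofPrime]
  exact (P.valuation_le_one f).antisymm (not_lt.mp ((P.valuation_lt_one_iff_mem f).not.mpr hf))

lemma eq_ofPrime {Q : Place K F} (hA : ∀ f : A, algebraMap A F f ∈ Q.ring)
    {P : IsDedekindDomain.HeightOneSpectrum A}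
    (hP : ∀ f, Q.valuation (algebraMap A F f) < 1 → f ∈ P.asIdeal) : Q = ofPrime P := by
  refine (eq_of_ring_le fun z hz => ?_).symm
  rw [← valuation_le_one_iff, valuation_ofPrime] at hz
  obtain ⟨f, ⟨g, hg⟩, hzg⟩ := P.exists_primeCompl_mul_eq_of_integer z hz
  have hle (f : A) : Q.valuation (algebraMap A F f) ≤ 1 := (Q.valuation_le_one_iff _).mpr (hA f)
  have hval : Q.valuation (algebraMap A F g) = 1 :=
    (hle g).antisymm (not_lt.mp fun hlt => hg (hP g hlt))
  have hmul := congrArg Q.valuation hzg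
  rw [map_mul, hval, mul_one] at hmul
  rw [← valuation_le_one_iff, hmul]
  exact hle f

/-- The place at a `K`-point `φ` of the affine curve with coordinate ring `A`. -/
noncomputable def ofAlgHom (φ : A →ₐ[K] K) (hφ : RingHom.ker φ ≠ ⊥) : Place K F :=
  ofPrime ⟨RingHom.ker φ, RingHom.ker_isPrime _, hφ⟩

lemma valuation_ofAlgHom_lt_one_iff {φ : A →ₐ[K] K} (hφ : RingHom.ker φ ≠ ⊥) {f : A} :
    (ofAlgHom φ hφ : Place K F).valuation (algebraMap A F f) < 1 ↔ φ f = 0 := by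
  rw [ofAlgHom, valuation_ofPrime, IsDedekindDomain.HeightOneSpectrum.valuation_lt_one_iff_mem,
    RingHom.mem_ker]

lemma isRational_ofAlgHom {φ : A →ₐ[K] K} (hφ : RingHom.ker φ ≠ ⊥) :
    (ofAlgHom φ hφ : Place K F).IsRational := by
  rw [isRational_iff]
  intro z hz
  rw [← valuation_le_one_iff, ofAlgHom, valuation_ofPrime] at hz
  obtain ⟨f, ⟨g, hg⟩, hzg⟩ :=
    IsDedekindDomain.HeightOneSpectrum.exists_primeCompl_mul_eq_of_integer _ z hz
  have hφg : φ g ≠ 0 := hg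
  refine ⟨φ f / φ g, ?_⟩
  have hsub : (z - algebraMap K F (φ f / φ g)) * algebraMap A F g =
      algebraMap A F (f - algebraMap K A (φ f / φ g) * g) := by
    rw [sub_mul, hzg, map_sub, map_mul, ← IsScalarTower.algebraMap_apply]
  have hval : (ofAlgHom φ hφ : Place K F).valuation (algebraMap A F g) = 1 :=
    valuation_ofPrime_eq_one hg
  rw [← mul_one ((ofAlgHom φ hφ).valuation _), ← hval, ← map_mul, hsub, hval,
    valuation_ofAlgHom_lt_one_iff]
  simp [div_mul_cancel₀ _ hφg]

end Place

namespace IsWeightValuation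

variable {K A F : Type*} [Field K] [CommRing A] [IsDedekindDomain A] [Field F] [Algebra K A]
  [Algebra A F] [IsFractionRing A F] [Algebra K F] [IsScalarTower K A F] {x : A}
  {v : Valuation A ℤᵐ⁰}

theorem weierstrassSemigroup_place (h : IsWeightValuation K x v)
    (hx : (aeval (R := K) x).IsIntegral) :
    (h.place F).weierstrassSemigroup = poleNumbers v := by
  ext N
  constructor
  · rintro ⟨z, hz, rfl, hreg⟩
    have hle (P : IsDedekindDomain.HeightOneSpectrum A) : P.valuation F z ≤ 1 := by
      rw [← Place.valuation_ofPrime (K := K) P, Place.valuation_le_one_iff,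
        ← Place.poleOrder_eq_zero_iff _ hz]
      refine hreg _ fun heq => h.algebraMap_notMem_place (F := F) ?_
      rw [← heq]
      exact Place.algebraMap_mem_ofPrime P x
    obtain ⟨f, rfl⟩ :=
      IsDedekindDomain.HeightOneSpectrum.mem_integers_of_valuation_le_one (R := A) F z hle
    obtain ⟨N, hN⟩ := h.exists_eq_exp (f := f) (fun h0 => hz (by rw [h0, map_zero]))
    rw [Place.poleOrder_eq (N := N) _ (by rw [place_valuation_algebraMap, hN])]
    exact ⟨f, hN⟩
  · rintro ⟨f, hf⟩
    have hf0 : algebraMap A F f ≠ 0 := fun h0 => by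
      rw [(map_eq_zero_iff _ (IsFractionRing.injective A F)).mp h0, map_zero] at hf
      exact exp_ne_zero hf.symm
    refine ⟨_, hf0, Place.poleOrder_eq _ (by rw [place_valuation_algebraMap, hf]), fun Q hQ => ?_⟩
    rw [Place.poleOrder_eq_zero_iff _ hf0]
    exact h.algebraMap_mem_of_ne_place hx hQ f

lemma setOf_isRational (h : IsWeightValuation K x v)
    (hx : (aeval (R := K) x).IsIntegral) :
    {Q : Place K F | Q.IsRational} = insert (h.place F)
      (Set.range fun φ : A →ₐ[K] K => Place.ofAlgHom φ (h.ker_ne_bot φ)) := by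
  refine Set.Subset.antisymm (fun Q hQ => ?_) (Set.insert_subset h.place_isRational ?_)
  · refine or_iff_not_imp_left.mpr fun hne => ?_
    have hreg := h.algebraMap_mem_of_ne_place hx hne
    obtain ⟨φ, hφ⟩ := Place.exists_algHom hQ hreg
    exact ⟨φ, (Place.eq_ofPrime (P := ⟨RingHom.ker φ, RingHom.ker_isPrime _, h.ker_ne_bot φ⟩) hreg
      fun f => (hφ f).mpr).symm⟩
  · rintro _ ⟨φ, rfl⟩
    exact Place.isRational_ofAlgHom _

theorem card_isRational [Finite (A →ₐ[K] K)] (h : IsWeightValuation K x v)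
    (hx : (aeval (R := K) x).IsIntegral) :
    Nat.card {Q : Place K F // Q.IsRational} = Nat.card (A →ₐ[K] K) + 1 := by
  have hinj : Function.Injective fun φ : A →ₐ[K] K =>
      (Place.ofAlgHom φ (h.ker_ne_bot φ) : Place K F) := by
    intro φ ψ hφψ
    ext f
    have hker : φ (f - algebraMap K A (φ f)) = 0 := by simp
    rw [← Place.valuation_ofAlgHom_lt_one_iff (F := F) (h.ker_ne_bot φ)] at hker
    rw [show Place.ofAlgHom φ _ = _ from hφψ, Place.valuation_ofAlgHom_lt_one_iff, map_sub,
      AlgHom.commutes, sub_eq_zero] at hker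
    exact hker.symm
  have hnotMem : h.place F ∉ Set.range fun φ : A →ₐ[K] K =>
      (Place.ofAlgHom φ (h.ker_ne_bot φ) : Place K F) := by
    rintro ⟨φ, hφ⟩
    exact h.algebraMap_notMem_place (F := F) (hφ ▸ Place.algebraMap_mem_ofPrime _ x)
  calc Nat.card {Q : Place K F // Q.IsRational} = {Q : Place K F | Q.IsRational}.ncard := rfl
    _ = Nat.card (A →ₐ[K] K) + 1 := by
      rw [h.setOf_isRational hx, Set.ncard_insert_of_notMem hnotMem (Set.finite_range _),
        ← Nat.card_coe_set_eq, Nat.card_range_of_injective hinj]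

end IsWeightValuation

end RationalPlaces

theorem formallyUnramified_adjoinRoot {R : Type*} [CommRing R] {P : R[X]}
    (hP : IsUnit (aeval (AdjoinRoot.root P) (derivative P))) :
    Algebra.FormallyUnramified R (AdjoinRoot P) := by
  rw [Algebra.FormallyUnramified.iff_comp_injective]
  intro B _ _ I hI φ ψ hφψ
  refine AdjoinRoot.algHom_ext ?_
  set z := ψ (AdjoinRoot.root P) with hz
  set ε := φ (AdjoinRoot.root P) - z with hε
  have hεI : ε ∈ I := Ideal.Quotient.eq.mp (DFunLike.congr_fun hφψ (AdjoinRoot.root P))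
  have hε2 : ε ^ 2 = 0 := by simpa [hI] using Ideal.pow_mem_pow hεI 2
  have hroot (χ : AdjoinRoot P →ₐ[R] B) : aeval (χ (AdjoinRoot.root P)) P = 0 := by
    rw [aeval_algHom_apply, AdjoinRoot.aeval_eq, AdjoinRoot.mk_self, map_zero]
  have htaylor := aeval_add_of_sq_eq_zero P z ε hε2
  rw [hε, add_sub_cancel, hroot, hz, hroot, zero_add, aeval_algHom_apply] at htaylor
  exact sub_eq_zero.mp ((hP.map ψ).mul_right_eq_zero.mp htaylor.symm)

lemma irreducible_of_isDomain_adjoinRoot {R : Type*} [CommRing R] [IsDomain R] {P : R[X]}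
    (hP : P ≠ 0) [h : IsDomain (AdjoinRoot P)] : Irreducible P :=
  ((Ideal.span_singleton_prime hP).mp ((Ideal.Quotient.isDomain_iff_prime _).mp h)).irreducible

section Remainder

variable {A : Type*} [CommSemiring A] {q : ℕ} {z : A}

lemma pow_pow_mod {n : ℕ} (hz : z ^ q ^ n = z) (r : ℕ) : z ^ q ^ (r % n) = z ^ q ^ r := by
  have hper : Function.IsPeriodicPt (· ^ q) n z := by
    simpa [Function.IsPeriodicPt, Function.IsFixedPt, pow_iterate] using hz
  simpa only [pow_iterate] using hper.iterate_mod_apply r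

lemma T_pow_one_add {s r : ℕ} (hz : z ^ q ^ (s + r) = z) :
    T q (s + r) (z ^ (1 + q ^ r)) = T q s (z ^ (1 + q ^ r)) + T q r (z ^ (1 + q ^ s)) := by
  simp only [T, Finset.sum_range_add]
  congr 1
  refine Finset.sum_congr rfl fun i _ => ?_
  calc (z ^ (1 + q ^ r)) ^ q ^ (s + i) = z ^ (q ^ s * q ^ i) * (z ^ q ^ (s + r)) ^ q ^ i := by ring
    _ = (z ^ (1 + q ^ s)) ^ q ^ i := by rw [hz]; ring

end Remainder

section CurvePoly

variable (K : Type*) [Field K] {q : ℕ}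

lemma monic_X_pow_pow_sub_X (hq : 2 ≤ q) {n : ℕ} (hn : n ≠ 0) :
    (X ^ q ^ n - X : K[X]).Monic :=
  monic_X_pow_sub (degree_X_le.trans_lt (by exact_mod_cast Nat.one_lt_pow hn hq))

lemma T_X_pow_mem_degreeLT {m k N : ℕ} (h : ∀ i < m, k * q ^ i < N) :
    T q m ((X : K[X]) ^ k) ∈ degreeLT K N := by
  refine Submodule.sum_mem _ fun i hi => ?_
  rw [mem_degreeLT, ← pow_mul, degree_X_pow]
  exact_mod_cast h i (Finset.mem_range.mp hi)

lemma aeval_fPoly {A : Type*} [CommRing A] [Algebra K A] {n : ℕ} (r : ℕ) {z : A}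
    (hz : z ^ q ^ n = z) : aeval z (fPoly K q n r) = T q n (z ^ (1 + q ^ r)) := by
  have h := congrArg (aeval z) (modByMonic_add_div (T q n ((X : K[X]) ^ (1 + q ^ r)))
    (X ^ q ^ n - X))
  rw [map_add, map_mul, map_sub, map_pow, aeval_X, hz, sub_self, zero_mul, add_zero] at h
  rw [fPoly, h, ← AlgHom.coe_toRingHom, map_T, AlgHom.coe_toRingHom, map_pow, aeval_X]

lemma fPoly_eq_of_mk_eq (hq : 2 ≤ q) {n r : ℕ} (hn : n ≠ 0) {P : K[X]}
    (hP : AdjoinRoot.mk (X ^ q ^ n - X) (T q n (X ^ (1 + q ^ r))) = AdjoinRoot.mk _ P) :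
    fPoly K q n r = P %ₘ (X ^ q ^ n - X) :=
  modByMonic_eq_of_dvd_sub (monic_X_pow_pow_sub_X K hq hn) (AdjoinRoot.mk_eq_mk.mp hP)

lemma mk_X_pow_eq (n : ℕ) : (AdjoinRoot.mk (X ^ q ^ n - X : K[X]) X) ^ q ^ n =
    AdjoinRoot.mk _ X := by
  rw [← map_pow]
  exact AdjoinRoot.mk_eq_mk.mpr dvd_rfl

lemma fPoly_mod (hq : 2 ≤ q) {n : ℕ} (hn : n ≠ 0) (r : ℕ) :
    fPoly K q n (r % n) = fPoly K q n r :=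
  fPoly_eq_of_mk_eq K hq hn (by
    simp only [map_T, map_pow, map_mul, pow_add, pow_pow_mod (mk_X_pow_eq K n) r])

lemma fPoly_eq (hq : 2 ≤ q) {s r : ℕ} (hs : s ≠ 0) (hr : r ≠ 0) :
    fPoly K q (s + r) r = T q s (X ^ (1 + q ^ r)) + T q r (X ^ (1 + q ^ s)) := by
  have hdeg (a b i : ℕ) (hb : b ≠ 0) (hi : i < a) : (1 + q ^ b) * q ^ i < q ^ (a + b) := by
    calc (1 + q ^ b) * q ^ i < (q ^ b + q ^ b) * q ^ i := by
          gcongr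
          exact Nat.one_lt_pow hb hq
      _ = 2 * q ^ (b + i) := by ring
      _ ≤ q * q ^ (b + i) := by gcongr
      _ = q ^ (b + i + 1) := (pow_succ' _ _).symm
      _ ≤ q ^ (a + b) := Nat.pow_le_pow_right (by omega) (by omega)
  have hmem : T q s ((X : K[X]) ^ (1 + q ^ r)) + T q r (X ^ (1 + q ^ s)) ∈
      degreeLT K (q ^ (s + r)) :=
    add_mem (T_X_pow_mem_degreeLT K fun i hi => hdeg s r i hr hi)
      (T_X_pow_mem_degreeLT K fun i hi => add_comm s r ▸ hdeg r s i hs hi)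
  have hn : s + r ≠ 0 := by omega
  have hmonic := monic_X_pow_pow_sub_X K hq hn
  have hmk := T_pow_one_add (mk_X_pow_eq (q := q) K (s + r))
  simp only [← map_pow, ← map_T, ← map_add] at hmk
  rw [fPoly_eq_of_mk_eq K hq hn hmk, (modByMonic_eq_self_iff hmonic).mpr]
  rwa [degree_eq_natDegree hmonic.ne_zero,
    FiniteField.X_pow_card_pow_sub_X_natDegree_eq K hn hq, ← mem_degreeLT]

lemma map_fPoly {L : Type*} [Field L] (φ : K →+* L) (hq : 2 ≤ q) {n : ℕ} (r : ℕ) (hn : n ≠ 0) :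
    (fPoly K q n r).map φ = fPoly L q n r := by
  rw [fPoly, fPoly, map_modByMonic _ (monic_X_pow_pow_sub_X K hq hn), ← coe_mapRingHom, map_T]
  simp

lemma map_curvePoly {L : Type*} [Field L] (φ : K →+* L) (hq : 2 ≤ q) {n : ℕ} (r : ℕ)
    (hn : n ≠ 0) : (curvePoly K q n r).map (mapRingHom φ) = curvePoly L q n r := by
  rw [curvePoly, curvePoly, ← coe_mapRingHom, map_sub, map_T]
  simp [map_fPoly K φ hq r hn]

lemma degree_T_X_lt {R : Type*} [CommRing R] (hq : 2 ≤ q) (m : ℕ) :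
    (T q m (X : R[X])).degree < (q ^ m : ℕ) := by
  rw [← mem_degreeLT]
  refine Submodule.sum_mem _ fun i hi => mem_degreeLT.mpr ((degree_X_pow_le _).trans_lt ?_)
  exact_mod_cast Nat.pow_lt_pow_right hq (Finset.mem_range.mp hi)

lemma curvePoly_eq_X_pow_add (hq : 2 ≤ q) (m r : ℕ) : ∃ P : K[X][X], P.degree < (q ^ m : ℕ) ∧
    curvePoly K q (m + 1) r = X ^ q ^ m + P := by
  refine ⟨T q m X - C (fPoly K q (m + 1) r), ?_, by rw [curvePoly, T_succ]; ring⟩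
  refine (degree_sub_le _ _).trans_lt (max_lt (degree_T_X_lt hq m) (degree_C_le.trans_lt ?_))
  exact_mod_cast pow_pos (by omega : 0 < q) m

lemma curvePoly_monic (hq : 2 ≤ q) (m r : ℕ) : (curvePoly K q (m + 1) r).Monic := by
  obtain ⟨P, hP, h⟩ := curvePoly_eq_X_pow_add K hq m r
  exact h ▸ monic_X_pow_add hP

lemma natDegree_curvePoly (hq : 2 ≤ q) (m r : ℕ) :
    (curvePoly K q (m + 1) r).natDegree = q ^ m := by
  obtain ⟨P, hP, h⟩ := curvePoly_eq_X_pow_add K hq m r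
  rw [h, natDegree_add_eq_left_of_degree_lt (by rwa [degree_X_pow]), natDegree_X_pow]

lemma derivative_curvePoly (hq0 : (q : K) = 0) (m r : ℕ) :
    derivative (curvePoly K q (m + 1) r) = 1 := by
  have hq0' : (q : K[X][X]) = 0 := by
    rw [← map_natCast (algebraMap K K[X][X]), hq0, map_zero]
  simp [curvePoly, T, Finset.sum_range_succ', derivative_X_pow, hq0']

end CurvePoly

section CoordinateRing

variable (K : Type*) [Field K] (q n r : ℕ)

/-- The coordinate function `x` in the coordinate ring. -/
noncomputable def xCoord : CoordinateRing K q n r := AdjoinRoot.of _ X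

/-- The coordinate function `y` in the coordinate ring. -/
noncomputable def yCoord : CoordinateRing K q n r := AdjoinRoot.root _

lemma algebraMap_eq_aeval (f : K[X]) :
    algebraMap K[X] (CoordinateRing K q n r) f = aeval (xCoord K q n r) f := by
  rw [xCoord, ← AdjoinRoot.algebraMap_eq, aeval_algebraMap_apply, aeval_X_left_apply]

lemma T_yCoord : T q n (yCoord K q n r) = aeval (xCoord K q n r) (fPoly K q n r) := by
  have h : AdjoinRoot.mk (curvePoly K q n r) (T q n X - C (fPoly K q n r)) = 0 :=
    AdjoinRoot.mk_self
  rw [map_sub, map_T, AdjoinRoot.mk_X, AdjoinRoot.mk_C, sub_eq_zero] at h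
  rw [← algebraMap_eq_aeval]
  exact h

lemma adjoin_coord : Algebra.adjoin K {xCoord K q n r, yCoord K q n r} = ⊤ := by
  have hy : yCoord K q n r ∈ Algebra.adjoin K {xCoord K q n r, yCoord K q n r} :=
    Algebra.subset_adjoin (by simp)
  refine eq_top_iff.mpr fun f _ => ?_
  induction f using AdjoinRoot.induction_on with
  | ih p =>
    rw [← AdjoinRoot.aeval_eq, aeval_eq_sum_range]
    refine sum_mem fun i _ => ?_
    rw [Algebra.smul_def, algebraMap_eq_aeval]
    refine mul_mem ?_ (pow_mem hy i)
    exact Algebra.adjoin_mono (by simp) (aeval_mem_adjoin_singleton K (xCoord K q n r))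

variable {K q n r}

/-- The `K`-points of the affine curve, as pairs of coordinates. -/
noncomputable def algHomEquiv : (CoordinateRing K q n r →ₐ[K] K) ≃
    {z : K × K // T q n z.2 = (fPoly K q n r).eval z.1} where
  toFun φ := ⟨(φ (xCoord K q n r), φ (yCoord K q n r)), by
    rw [← coe_aeval_eq_eval, aeval_algHom_apply, ← T_yCoord]
    exact (map_T φ.toRingHom q n _).symm⟩
  invFun z := AdjoinRoot.liftAlgHom _ (aeval z.1.1) z.1.2 (by
    have h := z.2
    rw [curvePoly, eval₂_sub, eval₂_C, ← coe_eval₂RingHom, map_T]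
    simp [h])
  left_inv φ := by
    refine AlgHom.ext_of_adjoin_eq_top (adjoin_coord K q n r) ?_
    rintro z (rfl | rfl) <;> simp [xCoord, yCoord]
  right_inv z := by simp [xCoord, yCoord]

end CoordinateRing

section Finite

variable {K : Type*} [Field K] {q : ℕ} (hq : 2 ≤ q) (m r : ℕ)

include hq

lemma isIntegral_aeval_xCoord : (aeval (R := K) (xCoord K q (m + 1) r)).IsIntegral := by
  have := (curvePoly_monic K hq m r).finite_adjoinRoot
  intro f
  obtain ⟨P, hP, hf⟩ := Algebra.IsIntegral.isIntegral (R := K[X]) f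
  refine ⟨P, hP, ?_⟩
  rwa [← RingHom.ext (f := algebraMap K[X] _) (algebraMap_eq_aeval K q (m + 1) r)]

lemma finrank_coordinateRing : Module.finrank K[X] (CoordinateRing K q (m + 1) r) = q ^ m := by
  rw [(AdjoinRoot.powerBasis' (curvePoly_monic K hq m r)).finrank, AdjoinRoot.powerBasis'_dim,
    natDegree_curvePoly K hq]

lemma nontrivial_coordinateRing : Nontrivial (CoordinateRing K q (m + 1) r) := by
  refine AdjoinRoot.nontrivial _ (natDegree_pos_iff_degree_pos.mp ?_).ne'
  rw [natDegree_curvePoly K hq]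
  exact pow_pos (by omega) m

lemma isDedekindDomain_coordinateRing (hq0 : (q : K) = 0)
    [IsDomain (CoordinateRing K q (m + 1) r)] :
    IsDedekindDomain (CoordinateRing K q (m + 1) r) := by
  have := (curvePoly_monic K hq m r).finite_adjoinRoot
  have : Algebra.FormallyUnramified K[X] (CoordinateRing K q (m + 1) r) :=
    formallyUnramified_adjoinRoot (by simp [derivative_curvePoly K hq0])
  exact isDedekindDomain.of_formallyUnramified K[X] _

end Finite

section PointCount

variable {K : Type*} [Field K] {q : ℕ}

lemma T_pow_self (h : PowAdditive K q) {n : ℕ} {z : K} (hz : z ^ q ^ n = z) :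
    T q n z ^ q = T q n z := by
  have hfix := T_succ (q := q) n z
  rw [hz, add_comm n, T_add_index h, T_one, pow_one, add_comm] at hfix
  exact add_right_cancel hfix

/-- The map `z ↦ T_n(z)`, which is the trace to the field with `q` elements when `K` has `q ^ n`
elements. -/
def THom (h : PowAdditive K q) (n : ℕ) : K →+ K :=
  AddMonoidHom.mk' (T q n) fun a b => by simp [T, h.add_pow, Finset.sum_add_distrib]

lemma card_ker_THom_le (h : PowAdditive K q) (hq : 2 ≤ q) (m : ℕ) :
    Nat.card (THom h (m + 1)).ker ≤ q ^ m := by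
  have hlt := degree_T_X_lt (R := K) hq m
  rw [← degree_X_pow (R := K)] at hlt
  have hdeg : (T q (m + 1) (X : K[X])).natDegree = q ^ m := by
    rw [T_succ, natDegree_add_eq_right_of_degree_lt hlt, natDegree_X_pow]
  have hne : T q (m + 1) (X : K[X]) ≠ 0 :=
    ne_zero_of_natDegree_gt (n := 0) (hdeg ▸ pow_pos (by omega) m)
  have hsub : ((THom h (m + 1)).ker : Set K) ⊆ (T q (m + 1) (X : K[X])).rootSet K := by
    intro z hz
    rw [mem_rootSet_of_ne hne, ← AlgHom.coe_toRingHom, map_T, AlgHom.coe_toRingHom, aeval_X]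
    exact hz
  exact (Set.ncard_le_ncard hsub (rootSet_finite _ _)).trans
    ((ncard_rootSet_le _ _).trans hdeg.le)

lemma card_range_THom_le (h : PowAdditive K q) (hq : 2 ≤ q) {n : ℕ}
    (hK : ∀ z : K, z ^ q ^ n = z) : Nat.card (THom h n).range ≤ q := by
  have hsub : ((THom h n).range : Set K) ⊆ (X ^ q - X : K[X]).rootSet K := by
    rintro _ ⟨z, rfl⟩
    rw [mem_rootSet_of_ne (FiniteField.X_pow_card_sub_X_ne_zero K hq), map_sub, map_pow, aeval_X,
      sub_eq_zero]
    exact T_pow_self h (hK z)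
  exact (Set.ncard_le_ncard hsub (rootSet_finite _ _)).trans
    ((ncard_rootSet_le _ _).trans (FiniteField.X_pow_card_sub_X_natDegree_eq K hq).le)

section

variable (h : PowAdditive K q) (hq : 2 ≤ q) {m : ℕ} (hK : Nat.card K = q ^ (m + 1))

include hq hK

lemma pow_eq_self_of_card_eq_pow (z : K) : z ^ q ^ (m + 1) = z := by
  have : Finite K := Nat.finite_of_card_ne_zero (hK ▸ (pow_pos (by omega) _).ne')
  have := Fintype.ofFinite K
  rw [← hK, Nat.card_eq_fintype_card, FiniteField.pow_card]

include h

lemma card_T_eq_zero : Nat.card {z : K // T q (m + 1) z = 0} = q ^ m := by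
  have hprod : Nat.card (THom h (m + 1)).ker * Nat.card (THom h (m + 1)).range = q ^ (m + 1) := by
    rw [← hK, ← AddSubgroup.index_ker, AddSubgroup.card_mul_index]
  have hrange := card_range_THom_le h hq (pow_eq_self_of_card_eq_pow hq hK)
  refine le_antisymm (card_ker_THom_le h hq m) (Nat.le_of_mul_le_mul_right ?_ (by omega : 0 < q))
  calc q ^ m * q = Nat.card (THom h (m + 1)).ker * Nat.card (THom h (m + 1)).range := by
        rw [hprod, pow_succ]
    _ ≤ Nat.card (THom h (m + 1)).ker * q := Nat.mul_le_mul_left _ hrange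

/-- On `K`-points the equation of the curve reads `T_n(y) = T_n(x ^ (1 + q ^ r))`, so that `x` is
arbitrary and `y` is determined up to the kernel of `T_n`. -/
lemma card_algHom_coordinateRing (r : ℕ) :
    Nat.card (CoordinateRing K q (m + 1) r →ₐ[K] K) = q ^ m * q ^ (m + 1) := by
  have hf (a : K) : (fPoly K q (m + 1) r).eval a = T q (m + 1) (a ^ (1 + q ^ r)) := by
    rw [← coe_aeval_eq_eval, aeval_fPoly K r (pow_eq_self_of_card_eq_pow hq hK a)]
  let e : {z : K × K // T q (m + 1) z.2 = (fPoly K q (m + 1) r).eval z.1} ≃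
      {z : K // T q (m + 1) z = 0} × K :=
    { toFun z := (⟨z.1.2 - z.1.1 ^ (1 + q ^ r), by rw [T_sub h, z.2, hf, sub_self]⟩, z.1.1)
      invFun w := ⟨(w.2, w.1.1 + w.2 ^ (1 + q ^ r)), by
        rw [hf, ← sub_eq_zero, ← T_sub h, add_sub_cancel_right, w.1.2]⟩
      left_inv z := by simp
      right_inv w := by simp }
  rw [Nat.card_congr (algHomEquiv.trans e), Nat.card_prod, card_T_eq_zero h hq hK, hK]

end

end PointCount

lemma isSymmetric_of_mem_iff_sub_notMem {S : Set ℕ} {l : ℕ} (h0 : 0 ∈ S)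
    (hle : ∀ N ≤ l, N ∈ S ↔ l - N ∉ S) (hlt : ∀ N, l < N → N ∈ S) : IsSymmetric S := by
  classical
  have hgap {N : ℕ} (hN : N ∉ S) : N ≤ l := not_lt.mp fun h => hN (hlt N h)
  refine ⟨l, ⟨by simpa using (hle 0 l.zero_le).mp h0, fun N => hgap⟩, ?_⟩
  have hgaps : Sᶜ = ((Finset.range (l + 1)).filter (· ∉ S) : Finset ℕ) := by
    ext N
    simpa [Nat.lt_succ_iff] using hgap
  have hcard : ((Finset.range (l + 1)).filter (· ∈ S)).card =
      ((Finset.range (l + 1)).filter (· ∉ S)).card := by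
    refine Finset.card_nbij' (l - ·) (l - ·) ?_ ?_ ?_ ?_ <;> intro N hN <;>
      simp only [Finset.mem_coe, Finset.mem_filter, Finset.mem_range, Nat.lt_succ_iff] at hN ⊢
    · exact ⟨by omega, (hle N hN.1).mp hN.2⟩
    · exact ⟨by omega, (hle _ (by omega)).mpr (by rw [Nat.sub_sub_self hN.1]; exact hN.2)⟩
    · exact Nat.sub_sub_self hN.1
    · exact Nat.sub_sub_self hN.1
  have hadd := Finset.card_filter_add_card_filter_not (s := Finset.range (l + 1)) (· ∈ S)
  rw [Finset.card_range] at hadd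
  rw [hgaps, Set.ncard_coe_finset]
  omega

namespace RewriteSystem

variable {K A ι : Type*} [Field K] [CommRing A] [Algebra K A] [Fintype ι] {x : A} {g : ι → A}
  {e : ℕ} {a p rk : ι → ℕ}

lemma mem_range_weight_iff (h : RewriteSystem K x g e a p rk) {c : ι → ℕ}
    (hc : ∀ i, c i < p i) {N : ℕ} (hN : ∑ i, c i * a i ≡ N [MOD e]) :
    N ∈ Set.range (weight e a) ↔ ∑ i, c i * a i ≤ N := by
  constructor
  · rintro ⟨m, rfl⟩
    obtain ⟨-, -, m', hm', hw, -⟩ := h.exists_reduced m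
    rw [← hw, weight] at hN ⊢
    have hcm : c = m'.2 := h.residue_injective _ _ hc hm' (hN.trans (by simp [Nat.ModEq]))
    exact hcm ▸ Nat.le_add_left _ _
  · intro hle
    obtain ⟨k, hk⟩ := (Nat.modEq_iff_dvd' hle).mp hN
    exact ⟨(k, c), by rw [weight, mul_comm, ← hk, Nat.sub_add_cancel hle]⟩

lemma add_le_of_notMem (h : RewriteSystem K x g e a p rk) {N : ℕ}
    (hN : N ∉ Set.range (weight e a)) : N + e ≤ ∑ i, (p i - 1) * a i := by
  obtain ⟨c, hc, hcN⟩ := h.exists_sum_modEq N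
  rw [h.mem_range_weight_iff hc hcN, not_le] at hN
  refine (hcN.symm.add_le_of_lt hN).trans ?_
  gcongr with i
  exact Nat.le_sub_one_of_lt (hc i)

/-- The map `c ↦ p - 1 - c` on the residues exchanges the gaps with the non-gaps. -/
theorem isSymmetric (h : RewriteSystem K x g e a p rk) (hone : 1 ∉ Set.range (weight e a)) :
    IsSymmetric (Set.range (weight e a)) := by
  obtain ⟨l, hl⟩ := Nat.exists_eq_add_of_le' (le_of_add_le_right (h.add_le_of_notMem hone))
  refine isSymmetric_of_mem_iff_sub_notMem (l := l) ⟨0, weight_zero⟩ (fun N hN => ?_) fun N hN => ?_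
  · obtain ⟨c, hc, hcN⟩ := h.exists_sum_modEq N
    have hc' (i : ι) : p i - 1 - c i < p i := by have := hc i; omega
    have hsum : ∑ i, (p i - 1 - c i) * a i + ∑ i, c i * a i = l + e := by
      rw [← hl, ← Finset.sum_add_distrib]
      refine Finset.sum_congr rfl fun i _ => ?_
      rw [← add_mul, Nat.sub_add_cancel (Nat.le_sub_one_of_lt (hc i))]
    have hcN' : ∑ i, (p i - 1 - c i) * a i ≡ l - N [MOD e] := by
      refine Nat.ModEq.add_right_cancel hcN ?_
      rw [hsum, Nat.sub_add_cancel hN]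
      exact Nat.add_modEq_right
    rw [h.mem_range_weight_iff hc hcN, h.mem_range_weight_iff hc' hcN', not_le]
    have := h.pos
    exact ⟨fun hle => by omega, fun hlt => by have := hcN'.symm.add_le_of_lt hlt; omega⟩
  · by_contra hgap
    have := h.add_le_of_notMem hgap
    omega

end RewriteSystem

section Rules

variable {K A ι : Type*} [Field K] [CommRing A] [Algebra K A] [Fintype ι] {x : A} {g : ι → A}
  {e : ℕ} {a : ι → ℕ} {N : ℕ}

lemma pow_mul_pow_mem_weightLT (m k : ℕ) (i : ι) (h : m * e + k * a i < N) :
    x ^ m * g i ^ k ∈ weightLT K x g e a N := by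
  classical
  rw [← monomialAt_fst (x := x) (g := g), ← monomialAt_single (x := x), ← monomialAt_add]
  refine monomialAt_mem_weightLT ?_
  rwa [weight_add, weight_fst, weight_single]

lemma mem_weightLT_of_lt (i : ι) (h : a i < N) : g i ∈ weightLT K x g e a N := by
  simpa using pow_mul_pow_mem_weightLT (K := K) (x := x) (g := g) (e := e) 0 1 i (by simpa using h)

lemma T_mem_weightLT {q : ℕ} (m : ℕ) (i : ι) (h : ∀ j < m, q ^ j * a i < N) :
    T q m (g i) ∈ weightLT K x g e a N := by
  refine Submodule.sum_mem _ fun j hj => ?_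
  simpa using pow_mul_pow_mem_weightLT (K := K) (x := x) (g := g) (e := e) 0 (q ^ j) i
    (by simpa using h j (Finset.mem_range.mp hj))

lemma HasRule.of_pow_eq {p rk : ι → ℕ} {i j : ι} {m k : ℕ} {c : K} {f : A} (hc : c ≠ 0)
    (hrule : g i ^ p i = c • (x ^ m * g j ^ k) + f) (hweight : m * e + k * a j = p i * a i)
    (hrank : k * rk j < p i * rk i) (hf : f ∈ weightLT K x g e a (p i * a i)) :
    HasRule K x g e a p rk i := by
  classical
  refine ⟨c, hc, (m, 0) + (0, Pi.single j k), ?_, ?_, ?_⟩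
  · rwa [weight_add, weight_fst, weight_single]
  · rwa [weight_add, weight_fst, weight_single, mul_zero, zero_add]
  · rwa [monomialAt_add, monomialAt_fst, monomialAt_single, hrule, add_sub_cancel_left]

end Rules

section GeneratorWeights

/-- The weight of `x` in the rewriting system of an `IsGeneratorSystem`, where `Q = q ^ σ` and
`D = q ^ d`. -/
def xWeight (q Q D : ℕ) : ℕ := q ^ 2 * Q ^ 2 * D

/-- The weights of the generators `y, t, u, w` of an `IsGeneratorSystem`, where `Q = q ^ σ`,
`D = q ^ d` and `E = q * D - 1`. They are forced by the requirement that each relation balance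
its two leading terms. -/
def genWeight (q Q D E : ℕ) : Fin 4 → ℕ :=
  ![q ^ 2 * Q ^ 2 * D + q * Q * D, q ^ 3 * Q ^ 2 * D + q * Q, q ^ 3 * Q ^ 2 * D ^ 2 + Q,
    q ^ 3 * Q ^ 2 * D * E + q ^ 2 * Q * D + 1]

/-- The powers of the generators `y, t, u, w` that the relations of an `IsGeneratorSystem`
rewrite, where `Q = q ^ σ` and `D = q ^ d`. -/
def genExponent (q Q D : ℕ) : Fin 4 → ℕ := ![q * Q, D, q, Q]

variable {q Q D E : ℕ}

lemma eq_of_dvd_sub {a b k : ℕ} (ha : a < k) (hb : b < k) (h : (k : ℤ) ∣ (a : ℤ) - b) : a = b :=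
  ((Nat.modEq_iff_dvd.mpr h).eq_of_lt_of_lt hb ha).symm

/-- The digits are recovered in the order `w, u, t, y`: the weights of the other generators are
divisible by `Q`, then by `q * Q`, then by `q * Q * D`. -/
lemma genWeight_residue_injective (hq : 0 < q) (hQ : 0 < Q) (hD : 0 < D) (c c' : Fin 4 → ℕ)
    (hc : ∀ i, c i < genExponent q Q D i) (hc' : ∀ i, c' i < genExponent q Q D i)
    (h : ∑ i, c i * genWeight q Q D E i ≡ ∑ i, c' i * genWeight q Q D E i
      [MOD xWeight q Q D]) : c = c' := by
  obtain ⟨k, hk⟩ := Nat.modEq_iff_dvd.mp h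
  simp only [genWeight, xWeight, Fin.sum_univ_four, Matrix.cons_val] at hk
  push_cast at hk
  have hw : c' 3 = c 3 := by
    refine eq_of_dvd_sub (hc' 3) (hc 3) ⟨q ^ 2 * Q * D * k
      - ((c' 0 : ℤ) - c 0) * (q ^ 2 * Q * D + q * D) - ((c' 1 : ℤ) - c 1) * (q ^ 3 * Q * D + q)
      - ((c' 2 : ℤ) - c 2) * (q ^ 3 * Q * D ^ 2 + 1)
      - ((c' 3 : ℤ) - c 3) * (q ^ 3 * Q * D * E + q ^ 2 * D), ?_⟩
    simp only [genExponent, Matrix.cons_val]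
    linear_combination hk
  rw [hw] at hk
  have hu : c' 2 = c 2 := by
    refine eq_of_dvd_sub (hc' 2) (hc 2) ⟨q * Q * D * k
      - ((c' 0 : ℤ) - c 0) * (q * Q * D + D) - ((c' 1 : ℤ) - c 1) * (q ^ 2 * Q * D + 1)
      - ((c' 2 : ℤ) - c 2) * (q ^ 2 * Q * D ^ 2), ?_⟩
    refine mul_left_cancel₀ (a := (Q : ℤ)) (by positivity) ?_
    simp only [genExponent, Matrix.cons_val]
    linear_combination hk
  rw [hu] at hk
  have ht : c' 1 = c 1 := by
    refine eq_of_dvd_sub (hc' 1) (hc 1) ⟨q * Q * k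
      - ((c' 0 : ℤ) - c 0) * (q * Q + 1) - ((c' 1 : ℤ) - c 1) * (q ^ 2 * Q), ?_⟩
    refine mul_left_cancel₀ (a := (q * Q : ℤ)) (by positivity) ?_
    simp only [genExponent, Matrix.cons_val]
    linear_combination hk
  rw [ht] at hk
  have hy : c' 0 = c 0 := by
    refine eq_of_dvd_sub (hc' 0) (hc 0) ⟨k - ((c' 0 : ℤ) - c 0), ?_⟩
    refine mul_left_cancel₀ (a := (q * Q * D : ℤ)) (by positivity) ?_
    simp only [genExponent, Matrix.cons_val, Nat.cast_mul]
    linear_combination hk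
  ext i
  fin_cases i
  exacts [hy.symm, ht.symm, hu.symm, hw.symm]

lemma mul_xWeight_add_xWeight (hE : E + 1 = q * D) :
    E * xWeight q Q D + xWeight q Q D = q ^ 3 * Q ^ 2 * D ^ 2 := by
  rw [← Nat.succ_mul, Nat.succ_eq_add_one, hE, xWeight]
  ring

lemma mul_xWeight_add_genWeight_zero (hE : E + 1 = q * D) :
    E * xWeight q Q D + genWeight q Q D E 0 = D * genWeight q Q D E 1 := by
  calc E * xWeight q Q D + genWeight q Q D E 0
      = E * xWeight q Q D + xWeight q Q D + q * Q * D := by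
        simp only [xWeight, genWeight, Matrix.cons_val]
        ring
    _ = D * genWeight q Q D E 1 := by
        rw [mul_xWeight_add_xWeight hE]
        simp only [genWeight, Matrix.cons_val]
        ring

lemma mul_xWeight_add_genWeight_one (hE : E + 1 = q * D) :
    q * E * xWeight q Q D + genWeight q Q D E 1 = q * genWeight q Q D E 2 := by
  calc q * E * xWeight q Q D + genWeight q Q D E 1
      = q * (E * xWeight q Q D + xWeight q Q D) + q * Q := by
        simp only [xWeight, genWeight, Matrix.cons_val]
        ring
    _ = q * genWeight q Q D E 2 := by
        rw [mul_xWeight_add_xWeight hE]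
        simp only [genWeight, Matrix.cons_val]
        ring

lemma mul_xWeight_add_genWeight_two {B : ℕ} (hE : E + 1 = q * D) (hB : B + 1 = q * Q) :
    B * E * xWeight q Q D + genWeight q Q D E 2 = Q * genWeight q Q D E 3 := by
  calc B * E * xWeight q Q D + genWeight q Q D E 2
      = B * E * xWeight q Q D + (E * xWeight q Q D + xWeight q Q D) + Q := by
        rw [mul_xWeight_add_xWeight hE, add_assoc]
        rfl
    _ = (B + 1) * E * xWeight q Q D + xWeight q Q D + Q := by ring
    _ = Q * genWeight q Q D E 3 := by
        rw [hB]
        simp only [xWeight, genWeight, Matrix.cons_val]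
        ring

lemma genWeight_one_lt_mul_genWeight_zero (hq : 2 ≤ q) (hQ : 0 < Q) (hD : 0 < D) :
    genWeight q Q D E 1 < q * genWeight q Q D E 0 := by
  have hlt : q * Q * 1 < q * Q * (q * D) :=
    Nat.mul_lt_mul_of_pos_left (by nlinarith) (by positivity)
  change q ^ 3 * Q ^ 2 * D + q * Q < q * (q ^ 2 * Q ^ 2 * D + q * Q * D)
  linarith

lemma genWeight_two_lt_mul_genWeight_one (hq : 2 ≤ q) (hQ : 0 < Q) (hD : 0 < D) :
    genWeight q Q D E 2 < D * genWeight q Q D E 1 := by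
  have hlt : Q * 1 < Q * (q * D) := Nat.mul_lt_mul_of_pos_left (by nlinarith) hQ
  change q ^ 3 * Q ^ 2 * D ^ 2 + Q < D * (q ^ 3 * Q ^ 2 * D + q * Q)
  linarith

lemma mul_xWeight_lt_genWeight_two (hQ : 0 < Q) (hE : E + 1 = q * D) :
    E * xWeight q Q D < genWeight q Q D E 2 := by
  have := mul_xWeight_add_xWeight (Q := Q) hE
  change _ < q ^ 3 * Q ^ 2 * D ^ 2 + Q
  omega

lemma genWeight_three_lt_mul_genWeight_two (hq : 2 ≤ q) (hQ : 0 < Q) (hE : E + 1 = q * D) :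
    genWeight q Q D E 3 < q * genWeight q Q D E 2 := by
  have hlead : q ^ 3 * Q ^ 2 * D * E + q ^ 3 * Q ^ 2 * D = q * (q ^ 3 * Q ^ 2 * D ^ 2) := by
    rw [← mul_xWeight_add_xWeight hE, xWeight]
    ring
  have hle : q ^ 2 * Q * D * 1 ≤ q ^ 2 * Q * D * (q * Q) :=
    Nat.mul_le_mul_left _ (Nat.mul_pos (by omega) hQ)
  change q ^ 3 * Q ^ 2 * D * E + q ^ 2 * Q * D + 1 < q * (q ^ 3 * Q ^ 2 * D ^ 2 + Q)
  nlinarith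

lemma genWeight_zero_lt_genWeight_three (hq : 1 ≤ q) (hE : 1 ≤ E) :
    genWeight q Q D E 0 < genWeight q Q D E 3 := by
  have hlead : q ^ 2 * Q ^ 2 * D * 1 ≤ q ^ 2 * Q ^ 2 * D * (q * E) :=
    Nat.mul_le_mul_left _ (Nat.mul_pos hq hE)
  have hle : q * Q * D * 1 ≤ q * Q * D * q := Nat.mul_le_mul_left _ hq
  change q ^ 2 * Q ^ 2 * D + q * Q * D < q ^ 3 * Q ^ 2 * D * E + q ^ 2 * Q * D + 1
  linarith

lemma genWeight_one_lt_genWeight_three (hq : 1 ≤ q) (hD : 0 < D) (hE : 1 ≤ E) :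
    genWeight q Q D E 1 < genWeight q Q D E 3 := by
  have hlead : q ^ 3 * Q ^ 2 * D * 1 ≤ q ^ 3 * Q ^ 2 * D * E := Nat.mul_le_mul_left _ hE
  have hle : q * Q * 1 ≤ q * Q * (q * D) := Nat.mul_le_mul_left _ (Nat.mul_pos hq hD)
  change q ^ 3 * Q ^ 2 * D + q * Q < q ^ 3 * Q ^ 2 * D * E + q ^ 2 * Q * D + 1
  linarith

lemma xWeight_lt_genWeight (hq : 1 ≤ q) (hQ : 0 < Q) (hD : 0 < D) (hE : 1 ≤ E) (i : Fin 4) :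
    xWeight q Q D < genWeight q Q D E i := by
  have hone : xWeight q Q D < genWeight q Q D E 1 := by
    have hle : q ^ 2 * Q ^ 2 * D * 1 ≤ q ^ 2 * Q ^ 2 * D * q := Nat.mul_le_mul_left _ hq
    have hpos : 0 < q * Q := by positivity
    change q ^ 2 * Q ^ 2 * D < q ^ 3 * Q ^ 2 * D + q * Q
    linarith
  fin_cases i
  · exact Nat.lt_add_of_pos_right (by positivity)
  · exact hone
  · have hle : q ^ 2 * Q ^ 2 * D * 1 ≤ q ^ 2 * Q ^ 2 * D * (q * D) :=
      Nat.mul_le_mul_left _ (Nat.mul_pos hq hD)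
    change q ^ 2 * Q ^ 2 * D < q ^ 3 * Q ^ 2 * D ^ 2 + Q
    linarith
  · exact hone.trans (genWeight_one_lt_genWeight_three hq hD hE)

lemma sub_mul_xWeight_add_lt_mul_genWeight_three {R : ℕ} (hR : R < Q) :
    (q * Q - q * R) * E * xWeight q Q D + R * genWeight q Q D E 3 < Q * genWeight q Q D E 3 := by
  obtain ⟨b, rfl⟩ := Nat.exists_eq_add_of_lt hR
  have hsub : q * (R + b + 1) - q * R = q * (b + 1) := by
    rw [← Nat.mul_sub, add_assoc, Nat.add_sub_cancel_left]
  rw [hsub]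
  change q * (b + 1) * E * (q ^ 2 * (R + b + 1) ^ 2 * D) + R * (q ^ 3 * (R + b + 1) ^ 2 * D * E
    + q ^ 2 * (R + b + 1) * D + 1) < (R + b + 1) * (q ^ 3 * (R + b + 1) ^ 2 * D * E
    + q ^ 2 * (R + b + 1) * D + 1)
  have hpos : 0 < (b + 1) * (q ^ 2 * (R + b + 1) * D + 1) := by positivity
  linarith

end GeneratorWeights

namespace IsGeneratorSystem

variable {K A : Type*} [Field K] [CommRing A] [Algebra K A] {q σ d : ℕ} {x y t u w : A}

lemma pow_sub_one_add_one (hq : 0 < q) : q ^ (d + 1) - 1 + 1 = q * q ^ d := by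
  rw [Nat.sub_add_cancel (Nat.pow_pos hq), pow_succ']

lemma T_mem_weightLT_of_pow_mul_lt {E N : ℕ} (hq : 0 < q)
    (h : q ^ σ * genWeight q (q ^ σ) (q ^ d) E 1 < N) :
    T q (σ + 1) t ∈
      weightLT K x ![y, t, u, w] (xWeight q (q ^ σ) (q ^ d)) (genWeight q (q ^ σ) (q ^ d) E) N :=
  T_mem_weightLT (g := ![y, t, u, w]) (σ + 1) 1 fun _ hj =>
    (Nat.mul_le_mul_right _ (Nat.pow_le_pow_right hq (Nat.lt_succ_iff.mp hj))).trans_lt h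

lemma hasRule_y (h : IsGeneratorSystem q σ d x y t u w) (hq : 2 ≤ q) :
    HasRule K x ![y, t, u, w] (xWeight q (q ^ σ) (q ^ d))
      (genWeight q (q ^ σ) (q ^ d) (q ^ (d + 1) - 1)) (genExponent q (q ^ σ) (q ^ d))
      ![1, 2, 3, 4] 0 := by
  have hQ : 0 < q ^ σ := by positivity
  have hD : 0 < q ^ d := by positivity
  refine .of_pow_eq (j := 0) (m := 1 + q * q ^ σ) (k := 0) (f := T q (σ + 1) t)
    (one_ne_zero (α := K)) ?_ ?_ ?_ (T_mem_weightLT_of_pow_mul_lt (by omega) ?_)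
  · have := h.y_pow
    simp only [pow_succ' q σ] at this
    simpa [genExponent] using this
  · simp only [xWeight, genWeight, genExponent, Matrix.cons_val]
    ring
  · simpa [genExponent] using ⟨by omega, hQ⟩
  · have hlt := genWeight_one_lt_mul_genWeight_zero (E := q ^ (d + 1) - 1) hq hQ hD
    calc q ^ σ * genWeight q (q ^ σ) (q ^ d) (q ^ (d + 1) - 1) 1
        < q ^ σ * (q * genWeight q (q ^ σ) (q ^ d) (q ^ (d + 1) - 1) 0) :=
          Nat.mul_lt_mul_of_pos_left hlt hQ
      _ = q * q ^ σ * genWeight q (q ^ σ) (q ^ d) (q ^ (d + 1) - 1) 0 := by ring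

lemma hasRule_t (h : IsGeneratorSystem q σ d x y t u w) (hq : 2 ≤ q) :
    HasRule K x ![y, t, u, w] (xWeight q (q ^ σ) (q ^ d))
      (genWeight q (q ^ σ) (q ^ d) (q ^ (d + 1) - 1)) (genExponent q (q ^ σ) (q ^ d))
      ![1, 2, 3, 4] 1 := by
  have hQ : 0 < q ^ σ := by positivity
  have hD : 0 < q ^ d := by positivity
  refine .of_pow_eq (j := 0) (m := q ^ (d + 1) - 1) (k := 1) (f := -(T q d t + u))
    (one_ne_zero (α := K)) ?_ ?_ ?_ (neg_mem (add_mem ?_ ?_))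
  · simpa [genExponent, sub_eq_add_neg] using h.t_pow
  · rw [one_mul]
    exact mul_xWeight_add_genWeight_zero (pow_sub_one_add_one (by omega))
  · simp [genExponent]
    omega
  · refine T_mem_weightLT (g := ![y, t, u, w]) d 1 fun j hj => ?_
    refine Nat.mul_lt_mul_of_pos_right (Nat.pow_lt_pow_right hq hj) ?_
    simp only [genWeight, Matrix.cons_val]
    positivity
  · exact mem_weightLT_of_lt (g := ![y, t, u, w]) 2 (genWeight_two_lt_mul_genWeight_one hq hQ hD)

lemma hasRule_u (h : IsGeneratorSystem q σ d x y t u w) (hq : 2 ≤ q) :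
    HasRule K x ![y, t, u, w] (xWeight q (q ^ σ) (q ^ d))
      (genWeight q (q ^ σ) (q ^ d) (q ^ (d + 1) - 1)) (genExponent q (q ^ σ) (q ^ d))
      ![1, 2, 3, 4] 2 := by
  have hQ : 0 < q ^ σ := by positivity
  have hE := pow_sub_one_add_one (d := d) (show 0 < q by omega)
  refine .of_pow_eq (j := 1) (m := q * (q ^ (d + 1) - 1)) (k := 1)
    (f := x ^ ((q - 1) * (q ^ (d + 1) - 1)) * u + w) (one_ne_zero (α := K)) ?_ ?_ ?_
    (add_mem ?_ ?_)
  · simpa [genExponent] using h.u_pow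
  · rw [one_mul]
    exact mul_xWeight_add_genWeight_one hE
  · simp [genExponent]
    omega
  · have hlt := mul_xWeight_lt_genWeight_two hQ hE
    refine (pow_one u).subst (motive := fun z => _ * z ∈ _)
      (pow_mul_pow_mem_weightLT (g := ![y, t, u, w]) _ 1 2 ?_)
    change _ < q * genWeight q (q ^ σ) (q ^ d) (q ^ (d + 1) - 1) 2
    calc _ = (q - 1) * ((q ^ (d + 1) - 1) * xWeight q (q ^ σ) (q ^ d))
          + genWeight q (q ^ σ) (q ^ d) (q ^ (d + 1) - 1) 2 := by ring
      _ < (q - 1) * genWeight q (q ^ σ) (q ^ d) (q ^ (d + 1) - 1) 2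
          + genWeight q (q ^ σ) (q ^ d) (q ^ (d + 1) - 1) 2 :=
        Nat.add_lt_add_right (Nat.mul_lt_mul_of_pos_left hlt (by omega)) _
      _ = _ := by rw [← Nat.succ_mul, Nat.succ_eq_add_one, Nat.sub_add_cancel (by omega)]
  · exact mem_weightLT_of_lt (g := ![y, t, u, w]) 3
      (genWeight_three_lt_mul_genWeight_two hq hQ hE)

lemma hasRule_w (h : IsGeneratorSystem q σ d x y t u w) (hq : 2 ≤ q) :
    HasRule K x ![y, t, u, w] (xWeight q (q ^ σ) (q ^ d))
      (genWeight q (q ^ σ) (q ^ d) (q ^ (d + 1) - 1)) (genExponent q (q ^ σ) (q ^ d))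
      ![1, 2, 3, 4] 3 := by
  have hQ : 0 < q ^ σ := by positivity
  have hD : 0 < q ^ d := by positivity
  have hE := pow_sub_one_add_one (d := d) (show 0 < q by omega)
  have hEpos : 1 ≤ q ^ (d + 1) - 1 := by
    have : 2 * 1 ≤ q * q ^ d := Nat.mul_le_mul hq hD
    omega
  refine .of_pow_eq (j := 2) (m := (q ^ (σ + 1) - 1) * (q ^ (d + 1) - 1)) (k := 1)
    (f := y + T q (σ + 1) t
      - ∑ j ∈ Finset.range σ, x ^ ((q ^ (σ + 1) - q ^ (j + 1)) * (q ^ (d + 1) - 1)) * w ^ q ^ j)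
    (neg_ne_zero.mpr (one_ne_zero (α := K))) ?_ ?_ ?_
    (sub_mem (add_mem (mem_weightLT_of_lt (g := ![y, t, u, w]) 0 ?_)
      (T_mem_weightLT_of_pow_mul_lt (by omega) ?_)) (Submodule.sum_mem _ fun j hj => ?_))
  · simpa [genExponent] using h.w_pow
  · rw [one_mul]
    exact mul_xWeight_add_genWeight_two hE (pow_sub_one_add_one (by omega))
  · simp [genExponent]
    omega
  · exact (genWeight_zero_lt_genWeight_three (by omega) hEpos).trans_le
      (Nat.le_mul_of_pos_left _ hQ)
  · exact Nat.mul_lt_mul_of_pos_left (genWeight_one_lt_genWeight_three (by omega) hD hEpos) hQ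
  · refine pow_mul_pow_mem_weightLT (g := ![y, t, u, w]) _ _ 3 ?_
    rw [pow_succ', pow_succ']
    exact sub_mul_xWeight_add_lt_mul_genWeight_three
      (Nat.pow_lt_pow_right hq (Finset.mem_range.mp hj))

lemma rewriteSystem (h : IsGeneratorSystem q σ d x y t u w) (hq : 2 ≤ q)
    (hadj : Algebra.adjoin K {x, y} = ⊤) :
    RewriteSystem K x ![y, t, u, w] (xWeight q (q ^ σ) (q ^ d))
      (genWeight q (q ^ σ) (q ^ d) (q ^ (d + 1) - 1)) (genExponent q (q ^ σ) (q ^ d))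
      ![1, 2, 3, 4] where
  adjoin_eq_top := by
    rw [eq_top_iff, ← hadj]
    exact Algebra.adjoin_mono (Set.insert_subset_insert (Set.singleton_subset_iff.mpr ⟨0, rfl⟩))
  hasRule i := by
    fin_cases i
    exacts [h.hasRule_y hq, h.hasRule_t hq, h.hasRule_u hq, h.hasRule_w hq]
  residue_injective :=
    genWeight_residue_injective (by omega) (Nat.pow_pos (by omega)) (Nat.pow_pos (by omega))
  prod_eq := by
    simp only [genExponent, xWeight, Fin.prod_univ_four, Matrix.cons_val]
    ring

end IsGeneratorSystem

lemma rewriteSystem_hermitian {K A : Type*} [Field K] [CommRing A] [Algebra K A] {q : ℕ}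
    (hq : 2 ≤ q) (htwo : (2 : K) ≠ 0) {x y : A} (hadj : Algebra.adjoin K {x, y} = ⊤)
    (h : y ^ q = (2 : K) • x ^ (1 + q) - y) : RewriteSystem K x ![y] q ![q + 1] ![q] ![1] where
  adjoin_eq_top := by
    rw [eq_top_iff, ← hadj]
    exact Algebra.adjoin_mono (Set.insert_subset_insert (Set.singleton_subset_iff.mpr ⟨0, rfl⟩))
  hasRule i := by
    obtain rfl := Subsingleton.elim i 0
    refine .of_pow_eq (j := 0) (m := 1 + q) (k := 0) (f := -y) htwo ?_ ?_ ?_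
      (neg_mem (mem_weightLT_of_lt (g := ![y]) 0 ?_))
    · simpa [sub_eq_add_neg] using h
    · simp [mul_comm, add_comm]
    · simp
      omega
    · simp
      nlinarith
  residue_injective c c' hc hc' hcc := by
    have hmod : c 0 ≡ c' 0 [MOD q] := by simpa [Nat.ModEq, mul_add] using hcc
    ext i
    rw [Subsingleton.elim i 0]
    exact hmod.eq_of_lt_of_lt (hc 0) (hc' 0)
  prod_eq := by simp

section CastleValuation

variable {K A : Type*} [Field K] [CommRing A] [Algebra K A] {x y : A} {e : ℕ}

/-- A weight valuation on `K[x, y]` as for the affine part of a Castle curve whose point at infinity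
is the point `(0 : 1 : 0)` of the plane: its pole numbers form a symmetric semigroup with smallest
nonzero element `e`, and `y` has a pole of larger order than `x`. -/
structure IsCastleValuation (K : Type*) {A : Type*} [Field K] [CommRing A] [Algebra K A] (x y : A)
    (e : ℕ) (v : Valuation A ℤᵐ⁰) : Prop where
  isWeightValuation : IsWeightValuation K x v
  isSymmetric : IsSymmetric (poleNumbers v)
  isLeast : IsLeast {N | N ∈ poleNumbers v ∧ N ≠ 0} e
  map_x_lt_map_y : v x < v y

section RewriteSystem

variable {ι : Type*} [Fintype ι] {g : ι → A} {a p rk : ι → ℕ}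

lemma isLeast_range_weight (he : e ≠ 0) (ha : ∀ i, e ≤ a i) :
    IsLeast {N | N ∈ Set.range (weight e a) ∧ N ≠ 0} e := by
  refine ⟨⟨⟨(1, 0), by rw [weight_fst, one_mul]⟩, he⟩, ?_⟩
  rintro _ ⟨⟨m, rfl⟩, hne⟩
  by_cases hk : m.1 = 0
  · obtain ⟨i, hi⟩ : ∃ i, m.2 i ≠ 0 := by
      by_contra! hc
      exact hne (by simp [weight, hk, hc])
    calc e ≤ a i := ha i
      _ ≤ m.2 i * a i := Nat.le_mul_of_pos_left _ (Nat.pos_of_ne_zero hi)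
      _ ≤ ∑ i, m.2 i * a i :=
        Finset.single_le_sum (f := fun i => m.2 i * a i) (fun _ _ => Nat.zero_le _)
          (Finset.mem_univ i)
      _ ≤ weight e a m := Nat.le_add_left _ _
  · exact (Nat.le_mul_of_pos_left e (Nat.pos_of_ne_zero hk)).trans (Nat.le_add_right _ _)

lemma RewriteSystem.exists_isCastleValuation [Nontrivial A] (h : RewriteSystem K x g e a p rk)
    (hli : LinearIndependent K (fun m : {m // Reduced p m} => monomialAt x g m.1)) (he : 1 < e)
    (ha : ∀ i, e < a i) {i : ι} (hy : g i = y) : ∃ v, IsCastleValuation K x y e v := by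
  classical
  obtain ⟨v, hv, hpole, hmon⟩ := h.exists_isWeightValuation hli
  have hleast := isLeast_range_weight (by omega) fun i => (ha i).le
  have hvx : v x = exp (e : ℤ) := by simpa [monomialAt_fst, weight_fst] using hmon (1, 0)
  have hvy : v y = exp (a i : ℤ) := by
    simpa [monomialAt_single, weight_single, hy] using hmon (0, Pi.single i 1)
  refine ⟨v, hv, ?_, by rwa [hpole], ?_⟩
  · rw [hpole]
    exact h.isSymmetric fun hone => he.not_ge (hleast.2 ⟨hone, one_ne_zero⟩)
  · rw [hvx, hvy, exp_lt_exp]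
    exact_mod_cast ha i

end RewriteSystem

end CastleValuation

section CoordinateRing

variable (K : Type*) [Field K] {q m r : ℕ}

lemma exists_T_yCoord_eq (hq : 2 ≤ q) {n : ℕ} (hn : 2 ≤ n) (hcop : Nat.Coprime n r) :
    ∃ s r', s ≠ 0 ∧ s ≤ r' ∧ s + r' = n ∧ Nat.Coprime r' s ∧
      T q (s + r') (yCoord K q n r) =
        T q s (xCoord K q n r ^ (1 + q ^ r')) + T q r' (xCoord K q n r ^ (1 + q ^ s)) := by
  have hlt : r % n < n := Nat.mod_lt _ (by omega)
  have hcop' : Nat.Coprime n (r % n) := ((ZMod.coprime_mod_iff_coprime r n).mpr hcop.symm).symm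
  have hr : r % n ≠ 0 := fun h0 => by
    rw [h0, Nat.coprime_zero_right] at hcop'
    omega
  obtain ⟨s, hs⟩ : ∃ s, s + r % n = n := ⟨n - r % n, Nat.sub_add_cancel hlt.le⟩
  have hs0 : s ≠ 0 := by omega
  have hsr : Nat.Coprime s (r % n) := Nat.coprime_add_self_left.mp (hs.symm ▸ hcop')
  have hf : T q n (yCoord K q n r) = T q s (xCoord K q n r ^ (1 + q ^ (r % n)))
      + T q (r % n) (xCoord K q n r ^ (1 + q ^ s)) := by
    have hfPoly := fPoly_eq K hq hs0 hr
    rw [hs, fPoly_mod K hq (by omega)] at hfPoly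
    have hT (i : ℕ) (P : K[X]) : aeval (xCoord K q n r) (T q i P) =
        T q i (aeval (xCoord K q n r) P) := map_T (aeval (xCoord K q n r)).toRingHom q i P
    rw [T_yCoord, hfPoly, map_add, hT, hT, map_pow, map_pow, aeval_X]
  obtain hle | hle := le_total s (r % n)
  · exact ⟨s, r % n, hs0, hle, hs, hsr.symm, by rw [hs, hf]⟩
  · exact ⟨r % n, s, hr, hle, by omega, hsr, by rw [add_comm (r % n), hs, hf, add_comm]⟩

variable {K}

lemma RewriteSystem.exists_isCastleValuation_coord (hq : 2 ≤ q) (hm : m ≠ 0) {ι : Type*}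
    [Fintype ι] {g : ι → CoordinateRing K q (m + 1) r} {e : ℕ} {a p rk : ι → ℕ}
    (h : RewriteSystem K (xCoord K q (m + 1) r) g e a p rk) (he : e = q ^ m)
    (ha : ∀ i, e < a i) {i : ι} (hy : g i = yCoord K q (m + 1) r) :
    ∃ v, IsCastleValuation K (xCoord K q (m + 1) r) (yCoord K q (m + 1) r) (q ^ m) v := by
  subst he
  have := nontrivial_coordinateRing (K := K) hq m r
  have hx : xCoord K q (m + 1) r = algebraMap K[X] _ X := by rw [algebraMap_eq_aeval, aeval_X]
  exact h.exists_isCastleValuation (h.linearIndependent hx (finrank_coordinateRing hq m r))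
    (Nat.one_lt_pow hm hq) ha hy

theorem exists_isCastleValuation (hadd : PowAdditive (CoordinateRing K q (m + 1) r) q)
    (hq : 2 ≤ q) (hm : m ≠ 0) (hcop : Nat.Coprime (m + 1) r) (htwo : m + 1 = 2 → (2 : K) ≠ 0) :
    ∃ v, IsCastleValuation K (xCoord K q (m + 1) r) (yCoord K q (m + 1) r) (q ^ m) v := by
  obtain ⟨s, r', hs, hle, hsum, hcop', hxy⟩ := exists_T_yCoord_eq K hq (by omega) hcop
  have hadj := adjoin_coord K q (m + 1) r
  obtain hlt | rfl := hle.lt_or_eq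
  · obtain ⟨σ, rfl⟩ : ∃ σ, s = σ + 1 := Nat.exists_eq_succ_of_ne_zero hs
    obtain ⟨d, rfl⟩ : ∃ d, r' = σ + 1 + (d + 1) := Nat.exists_eq_add_of_lt hlt
    obtain rfl : m = 2 * σ + 2 + d := by omega
    obtain ⟨t, u, w, h⟩ := exists_isGeneratorSystem hadd (by omega) hcop' hxy
    have hE : 1 ≤ q ^ (d + 1) - 1 := Nat.le_sub_one_of_lt (Nat.one_lt_pow d.succ_ne_zero hq)
    exact (h.rewriteSystem hq hadj).exists_isCastleValuation_coord hq hm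
      (by rw [xWeight]; ring)
      (xWeight_lt_genWeight (by omega) (Nat.pow_pos (by omega)) (Nat.pow_pos (by omega)) hE)
      (i := 0) rfl
  · obtain rfl : s = 1 := by simpa using hcop'
    obtain rfl : m = 1 := by omega
    have hrel : yCoord K q 2 r ^ q = (2 : K) • xCoord K q 2 r ^ (1 + q) - yCoord K q 2 r := by
      rw [T_succ, T_one, pow_one, T_one] at hxy
      rw [Algebra.smul_def, map_ofNat]
      linear_combination hxy
    exact (rewriteSystem_hermitian hq (htwo rfl) hadj hrel).exists_isCastleValuation_coord hq hm
      (pow_one q).symm (fun i => by simp) (i := 0) rfl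

/-- If `y` is regular at `Q`, then `1 / y` does not vanish there, and all places other than the
place of `v` are of this kind. -/
lemma IsCastleValuation.liesOverInfinity_iff [IsDomain (CoordinateRing K q (m + 1) r)] {e : ℕ}
    {v : Valuation (CoordinateRing K q (m + 1) r) ℤᵐ⁰} (hq : 2 ≤ q)
    (h : IsCastleValuation K (xCoord K q (m + 1) r) (yCoord K q (m + 1) r) e v)
    (Q : Place K (FunctionField K q (m + 1) r)) :
    LiesOverInfinity K q (m + 1) r Q ↔ Q = h.isWeightValuation.place _ := by
  have hx : xFun K q (m + 1) r = algebraMap _ _ (xCoord K q (m + 1) r) := rfl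
  have hy : yFun K q (m + 1) r = algebraMap _ _ (yCoord K q (m + 1) r) := rfl
  have hvy : 1 < v (yCoord K q (m + 1) r) :=
    h.isWeightValuation.one_lt_map_x.trans h.map_x_lt_map_y
  have hvy0 : 0 < v (yCoord K q (m + 1) r) := zero_lt_one.trans hvy
  constructor
  · rintro ⟨-, hpole⟩
    by_contra hQ
    have hregular := h.isWeightValuation.algebraMap_mem_of_ne_place
      (isIntegral_aeval_xCoord hq m r) hQ (yCoord K q (m + 1) r)
    rw [← Place.valuation_le_one_iff, ← hy] at hregular
    have hy0 : yFun K q (m + 1) r ≠ 0 := by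
      rw [hy, Ne, FaithfulSMul.algebraMap_eq_zero_iff]
      rintro h0
      simp [h0] at hvy0
    rw [map_div₀, map_one, one_div,
      inv_lt_one₀ (zero_lt_iff.mpr ((Valuation.ne_zero_iff _).mpr hy0))] at hpole
    exact hregular.not_gt hpole
  · rintro rfl
    rw [LiesOverInfinity, hx, hy, map_div₀, map_div₀, map_one,
      IsWeightValuation.place_valuation_algebraMap, IsWeightValuation.place_valuation_algebraMap,
      div_lt_one₀ hvy0, div_lt_one₀ hvy0]
    exact ⟨h.map_x_lt_map_y, hvy⟩

end CoordinateRing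

section FiniteCharacteristic

variable {q m r : ℕ}

lemma two_ne_zero_of_odd {K : Type*} [Field K] (hq0 : (q : K) = 0) (hodd : Odd q) :
    (2 : K) ≠ 0 := by
  obtain ⟨j, rfl⟩ := hodd
  intro htwo
  simp [htwo] at hq0

section

variable (K : Type*) [Field K] (p : ℕ) [Fact p.Prime] [CharP K p] {k : ℕ} (hqp : p ^ k = q)
  (hq : 2 ≤ q) (hm : m ≠ 0) (hcop : Nat.Coprime (m + 1) r) (hodd : m + 1 = 2 → Odd q)

include hqp hq hm hcop hodd

lemma exists_isCastleValuation_of_charP :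
    ∃ v, IsCastleValuation K (xCoord K q (m + 1) r) (yCoord K q (m + 1) r) (q ^ m) v := by
  subst hqp
  have := nontrivial_coordinateRing (K := K) hq m r
  have : CharP (CoordinateRing K (p ^ k) (m + 1) r) p :=
    charP_of_injective_algebraMap (algebraMap K _).injective p
  have hk : k ≠ 0 := by
    rintro rfl
    simp at hq
  have hq0 : ((p ^ k : ℕ) : K) = 0 := by rw [Nat.cast_pow, CharP.cast_eq_zero, zero_pow hk]
  exact exists_isCastleValuation (.of_charP p k) hq hm hcop fun h =>
    two_ne_zero_of_odd hq0 (hodd h)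

theorem isGeometricallyIrreducible : IsGeometricallyIrreducible K q (m + 1) r := by
  have : CharP (AlgebraicClosure K) p :=
    charP_of_injective_algebraMap (algebraMap K (AlgebraicClosure K)).injective p
  obtain ⟨v, h⟩ := exists_isCastleValuation_of_charP (AlgebraicClosure K) p hqp hq hm hcop hodd
  have := nontrivial_coordinateRing (K := AlgebraicClosure K) hq m r
  have := h.isWeightValuation.isDomain
  rw [IsGeometricallyIrreducible, map_curvePoly K _ hq r m.succ_ne_zero]
  exact irreducible_of_isDomain_adjoinRoot (curvePoly_monic _ hq m r).ne_zero

end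

lemma IsWeightValuation.card_isRational_coordinateRing {K : Type*} [Field K]
    [IsDedekindDomain (CoordinateRing K q (m + 1) r)]
    {v : Valuation (CoordinateRing K q (m + 1) r) ℤᵐ⁰}
    (h : IsWeightValuation K (xCoord K q (m + 1) r) v) (hadd : PowAdditive K q) (hq : 2 ≤ q)
    (hK : Nat.card K = q ^ (m + 1)) :
    Nat.card {Q : Place K (FunctionField K q (m + 1) r) // Q.IsRational} =
      q ^ m * q ^ (m + 1) + 1 := by
  have hcard := card_algHom_coordinateRing hadd hq hK r
  have : Finite (CoordinateRing K q (m + 1) r →ₐ[K] K) :=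
    Nat.finite_of_card_ne_zero (by rw [hcard]; positivity)
  rw [h.card_isRational (isIntegral_aeval_xCoord hq m r), hcard]

end FiniteCharacteristic

end CastleCurve

theorem mainTheorem3_general (K : Type*) [Field K] (q n r : ℕ) (hq : IsPrimePow q)
    (hK : Nat.card K = q ^ n) (hn : 2 ≤ n) (hcop : Nat.Coprime n r) (hodd : n = 2 → Odd q) :
    CastleCurve.IsGeometricallyIrreducible K q n r ∧
    ∃ _ : IsDomain (CastleCurve.CoordinateRing K q n r),
    ∃ Pinf : CastleCurve.Place K (CastleCurve.FunctionField K q n r),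
      (∀ Q : CastleCurve.Place K (CastleCurve.FunctionField K q n r),
        CastleCurve.LiesOverInfinity K q n r Q ↔ Q = Pinf) ∧
      CastleCurve.IsCastle Pinf ∧
      IsLeast {m | m ∈ Pinf.weierstrassSemigroup ∧ m ≠ 0} (q ^ (n - 1)) ∧
      Nat.card {Q : CastleCurve.Place K (CastleCurve.FunctionField K q n r) // Q.IsRational} =
        q ^ (n - 1) * q ^ n + 1 := by
  open CastleCurve in
  obtain ⟨m, rfl⟩ : ∃ m, n = m + 1 := ⟨n - 1, by omega⟩
  have hm : m ≠ 0 := by omega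
  have hq2 := hq.two_le
  obtain ⟨p, k, hp, hk, hqp⟩ := hq
  have : Fact p.Prime := ⟨hp.nat_prime⟩
  have := nontrivial_coordinateRing (K := K) hq2 m r
  have : Finite K := Nat.finite_of_card_ne_zero (by rw [hK]; positivity)
  have := Fintype.ofFinite K
  have : CharP K p := charP_of_card_eq_prime_pow (f := k * (m + 1)) (by
    rw [pow_mul, hqp, ← hK, Nat.card_eq_fintype_card])
  have hq0 : (q : K) = 0 := by rw [← hqp, Nat.cast_pow, CharP.cast_eq_zero, zero_pow hk.ne']
  obtain ⟨v, h⟩ := exists_isCastleValuation_of_charP K p hqp hq2 hm hcop hodd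
  have hdom := h.isWeightValuation.isDomain
  have := isDedekindDomain_coordinateRing hq2 m r hq0
  have hsemigroup := h.isWeightValuation.weierstrassSemigroup_place
    (F := FunctionField K q (m + 1) r) (isIntegral_aeval_xCoord hq2 m r)
  have hcard := h.isWeightValuation.card_isRational_coordinateRing (hqp ▸ .of_charP p k) hq2 hK
  refine ⟨isGeometricallyIrreducible K p hqp hq2 hm hcop hodd, hdom,
    h.isWeightValuation.place _, h.liesOverInfinity_iff hq2,
    ⟨h.isWeightValuation.place_isRational, ?_, q ^ m, ?_, hK ▸ hcard⟩, ?_, hcard⟩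
  all_goals rw [hsemigroup]
  exacts [h.isSymmetric, h.isLeast, h.isLeast]

theorem mainTheorem3 (K : Type*) [Field K] (q n r : ℕ) (hq : IsPrimePow q)
    (hK : Nat.card K = q ^ n) (hn : 2 ≤ n) (hr : n ≤ 2 * r) (hrn : r < n)
    (hcop : Nat.Coprime n r) (hodd : n = 2 → Odd q) :
    CastleCurve.IsGeometricallyIrreducible K q n r ∧
    ∃ _ : IsDomain (CastleCurve.CoordinateRing K q n r),
    ∃ Pinf : CastleCurve.Place K (CastleCurve.FunctionField K q n r),
      (∀ Q : CastleCurve.Place K (CastleCurve.FunctionField K q n r),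
        CastleCurve.LiesOverInfinity K q n r Q ↔ Q = Pinf) ∧
      CastleCurve.IsCastle Pinf ∧
      IsLeast {m | m ∈ Pinf.weierstrassSemigroup ∧ m ≠ 0} (q ^ (n - 1)) ∧
      Nat.card {Q : CastleCurve.Place K (CastleCurve.FunctionField K q n r) // Q.IsRational} =
        q ^ (n - 1) * q ^ n + 1 :=
  mainTheorem3_general K q n r hq hK hn hcop hodd
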